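/- Let $\partial_t^{\alpha}f(t)=\frac1{\Gamma(-\alpha)}\int_0^t\frac{f(\xi)}{(t-\xi)^{\alpha+1}}\,d\xi$ for $\alpha<0$ (Riemann–Liouville fractional integral), and $\partial_t^{\rho}f=\frac{d}{dt}\partial_t^{\rho-1}f$ for $0<\rho<1$ (Riemann–Liouville fractional derivative). Let $E_{\rho,\mu}(z)=\sum_{k=0}^\infty \frac{z^k}{\Gamma(\rho k+\mu)}$. Let $\varphi\in C^1[0,\pi]$ be real-valued with $\varphi'(0)=\varphi'(\pi)=0$, let $t_0\ge 1$ and $d_0\in\mathbb R$, and put $\varphi_1=\int_0^\pi\varphi(x)\,dx$. Consider the inverse problem of finding a real-valued function $u$ on $[0,\pi]\times(0,\infty)$ and an order $\rho\in(0,1)$ such that $$\partial_t^\rho u(x,t)-u_{xx}(x,t)=0\quad (0<x<\pi,\ t>0),\qquad \lim_{t\to0+}\partial_t^{\rho-1}u(x,t)=\varphi(x)\quad (0\le x\le\pi),$$ $$u_x(0,t)=u_x(\pi,t)=0\quad(t>0),\qquad \int_0^\pi u(x,t_0)\,dx=d_0 .$$ A solution is a pair $\{u,\rho\}$ satisfying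 these conditions in the classical sense, where $u$, $u_{xx}$ and $\partial_t^\rho u$ exist and are continuous on $[0,\pi]\times(0,\infty)$ (with one-sided $x$-derivatives at $x=0,\pi$), and $\partial_t^{\rho-1}u$ exists for $t>0$ (as an absolutely convergent integral) and extends to a continuous function on $[0,\pi]\times[0,\infty)$. **Theorem.** If $$0<\frac{d_0}{\varphi_1}<1,$$ then the inverse problem has a unique solution $\{u,\rho\}$. Moreover, $\rho$ is the unique root in $(0,1)$ of the equation $$\frac{t_0^{\rho-1}}{\Gamma(\rho)}=\frac{d_0}{\varphi_1},$$ and $$u(x,t)=\sum_{k=0}^\infty c_k\,t^{\rho-1}E_{\rho,\rho}(-k^2t^\rho)\cos kx,\qquad t>0,\ x\in[0,\pi],$$ where $c_0=\frac1\pi\int_0^\pi\varphi(x)\,dx$ and $c_k=\frac2\pi\int_0^\pi\varphi(x)\cos kx\,dx$ for $k\ge1$; the series converges absolutely. -/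

import Mathlib

open Set Filter Topology MeasureTheory

noncomputable section

/-- Riemann–Liouville fractional integral `∂_t^α f (t)` of (negative) order `α < 0`:
`(1 / Γ(-α)) ∫_0^t f(ξ) / (t - ξ)^(α + 1) dξ`. -/
def rlIntegral (α : ℝ) (f : ℝ → ℝ) (t : ℝ) : ℝ :=
  1 / Real.Gamma (-α) * ∫ ξ in (0 : ℝ)..t, f ξ / (t - ξ) ^ (α + 1)

/-- The fractional integral of order `α < 0` of `f` exists at the point `t`
(as an absolutely convergent Lebesgue integral). -/
def RLIntegrable (α : ℝ) (f : ℝ → ℝ) (t : ℝ) : Prop :=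
  IntervalIntegrable (fun ξ => f ξ / (t - ξ) ^ (α + 1)) volume 0 t

/-- Riemann–Liouville fractional derivative of order `ρ`, `0 < ρ < 1`:
`∂_t^ρ f = (d/dt) ∂_t^(ρ - 1) f`. -/
def rlDeriv (ρ : ℝ) (f : ℝ → ℝ) (t : ℝ) : ℝ :=
  deriv (rlIntegral (ρ - 1) f) t

/-- The Mittag-Leffler function `E_{ρ,μ}(z) = ∑_{k ≥ 0} z^k / Γ(ρ k + μ)`. -/
def mittagLeffler (ρ μ z : ℝ) : ℝ :=
  ∑' k : ℕ, z ^ k / Real.Gamma (ρ * k + μ)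

/-- `u_x (x, t)` on the closed interval `[0, π]` (one-sided at the end points). -/
def spaceDeriv (u : ℝ → ℝ → ℝ) (x t : ℝ) : ℝ :=
  derivWithin (fun y => u y t) (Icc 0 Real.pi) x

/-- `u_xx (x, t)` on the closed interval `[0, π]` (one-sided at the end points). -/
def spaceDeriv₂ (u : ℝ → ℝ → ℝ) (x t : ℝ) : ℝ :=
  spaceDeriv (spaceDeriv u) x t

/-- `u` is a classical solution of the forward problem of order `ρ` on `[0, π] × (0, ∞)`:
`∂_t^ρ u = u_xx`, `u_x(0, t) = u_x(π, t) = 0`, `lim_{t → 0} ∂_t^(ρ - 1) u(x, t) = φ(x)`.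
Only the values `u x t` with `x ∈ [0, π]` and `t > 0` matter. -/
structure IsForwardSolution (ρ : ℝ) (φ : ℝ → ℝ) (u : ℝ → ℝ → ℝ) : Prop where
  /-- `u` is continuous on `[0, π] × (0, ∞)`. -/
  continuousOn : ContinuousOn (fun p : ℝ × ℝ => u p.1 p.2) (Icc 0 Real.pi ×ˢ Ioi 0)
  /-- `u_x` exists. -/
  differentiableOn : ∀ t > 0, DifferentiableOn ℝ (fun x => u x t) (Icc 0 Real.pi)
  /-- `u_xx` exists. -/
  differentiableOn₂ : ∀ t > 0, DifferentiableOn ℝ (fun x => spaceDeriv u x t) (Icc 0 Real.pi)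
  /-- `u_xx ∈ C([0, π] × (0, ∞))`. -/
  continuousOn_spaceDeriv₂ :
    ContinuousOn (fun p : ℝ × ℝ => spaceDeriv₂ u p.1 p.2) (Icc 0 Real.pi ×ˢ Ioi 0)
  /-- `∂_t^(ρ - 1) u` exists. -/
  rlIntegrable : ∀ x ∈ Icc 0 Real.pi, ∀ t > 0, RLIntegrable (ρ - 1) (u x) t
  /-- `∂_t^(ρ - 1) u ∈ C([0, π] × [0, ∞))`: it extends continuously up to `t = 0`. -/
  continuousOn_rlIntegral : ∃ g : ℝ × ℝ → ℝ, ContinuousOn g (Icc 0 Real.pi ×ˢ Ici 0) ∧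
    ∀ x ∈ Icc 0 Real.pi, ∀ t > 0, g (x, t) = rlIntegral (ρ - 1) (u x) t
  /-- `∂_t^ρ u` exists. -/
  differentiableAt_rlIntegral : ∀ x ∈ Icc 0 Real.pi, ∀ t > 0,
    DifferentiableAt ℝ (rlIntegral (ρ - 1) (u x)) t
  /-- `∂_t^ρ u ∈ C([0, π] × (0, ∞))`. -/
  continuousOn_rlDeriv :
    ContinuousOn (fun p : ℝ × ℝ => rlDeriv ρ (u p.1) p.2) (Icc 0 Real.pi ×ˢ Ioi 0)
  /-- The equation. -/
  equation : ∀ x ∈ Ioo 0 Real.pi, ∀ t > 0, rlDeriv ρ (u x) t - spaceDeriv₂ u x t = 0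
  /-- The initial condition. -/
  initial : ∀ x ∈ Icc 0 Real.pi,
    Tendsto (fun t => rlIntegral (ρ - 1) (u x) t) (𝓝[>] 0) (𝓝 (φ x))
  /-- The Neumann condition at `x = 0`. -/
  neumann_zero : ∀ t > 0, spaceDeriv u 0 t = 0
  /-- The Neumann condition at `x = π`. -/
  neumann_pi : ∀ t > 0, spaceDeriv u Real.pi t = 0

/-- The pair `{u, ρ}` is a classical solution of the inverse problem with observation
`∫_0^π u(x, t₀) dx = d₀`. -/
structure IsInverseSolution (φ : ℝ → ℝ) (t₀ d₀ : ℝ) (u : ℝ → ℝ → ℝ) (ρ : ℝ) : Prop where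
  order_mem : ρ ∈ Ioo (0 : ℝ) 1
  forward : IsForwardSolution ρ φ u
  observation : ∫ x in (0 : ℝ)..Real.pi, u x t₀ = d₀

/-- Fourier coefficients of `φ` with respect to the orthogonal system `cos (k x)`, `k ≥ 0`, of
`L₂(0, π)`: `(φ, cos (k ·)) / ‖cos (k ·)‖²`, where `‖1‖² = π` and `‖cos (k ·)‖² = π / 2` for
`k ≥ 1`. -/
def cosCoeff (φ : ℝ → ℝ) (k : ℕ) : ℝ :=
  (if k = 0 then 1 / Real.pi else 2 / Real.pi) * ∫ x in (0 : ℝ)..Real.pi, φ x * Real.cos (k * x)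

end

/-!
A Fourier cosine expansion in `x` reduces everything to the scalar relaxation equation
`∂_t^ρ r = -l r`, whose fundamental solution is `relaxation ρ l t = t^(ρ-1) E_{ρ,ρ}(-l t^ρ)`.

*Existence.* The initial datum is only `C¹`, so its cosine coefficients are absolutely summable
(`summable_abs_cosCoeff`), but no faster decay is available. Hence the series of `u`, `u_xx` and `∂_t^ρ u` converge
once `E_{ρ,ρ}(-z)` and `z E_{ρ,ρ}(-z)` are bounded for `z ≥ 0`, and that of `∂_t^(ρ-1) u` converges
uniformly up to `t = 0` once `E_{ρ,1}(-z)` is bounded. These bounds follow without contour integrals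
from a maximum principle: at a first zero of a function that was positive before, the fractional
derivative is negative (`deriv_rlIntegral_neg_of_first_zero`). Applied to `r_l` it gives
`E_{ρ,ρ}(-z) > 0`, and applied to `r_l - r_m` with `l < m` it gives that `E_{ρ,ρ}(-z)` decreases in
`z`; since `E_{ρ,ρ}(-z)` is, up to the factor `-ρ`, the derivative of `E_{ρ,1}(-z)`, which takes
values in `[0, 1]`, monotonicity yields `z E_{ρ,ρ}(-z) ≤ 2 ρ` (`mul_mittagLeffler_self_neg_le`).

*Uniqueness for a given order.* Let `G` be the `k`-th cosine moment of `∂_t^(ρ-1) v`. Abel's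
inversion (`rlIntegral_rlIntegral`) and the equation integrated in `x` and `t` give the Volterra
equation `G = G(0) - k² ∂_t^(-ρ) G` (`IsForwardSolution.exists_cos_moment`), whose continuous solution
is unique because `∂_t^(-ρ)` is a contraction in a norm with exponential weight. So two solutions
have the same cosine moments, and cosines are complete.

*The order.* By uniqueness every solution of order `σ` is the series solution of order `σ`, whose
mean value at `t₀` is `φ₁ t₀^(σ-1) / Γ(σ)`. As `t₀ ≥ 1`, the function `σ ↦ t₀^(σ-1) / Γ(σ)` increases
strictly and continuously on `(0, 1)` from `0` to `1`, so the observation determines the order.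
-/

/-! ### Euler's Beta integral and the growth of the Gamma function -/

theorem integral_beta_scaled {a b t : ℝ} (ha : 0 < a) (hb : 0 < b) (ht : 0 < t) :
    ∫ ξ in (0 : ℝ)..t, ξ ^ (a - 1) * (t - ξ) ^ (b - 1) =
      Real.Gamma a * Real.Gamma b / Real.Gamma (a + b) * t ^ (a + b - 1) := by
  have h := Complex.betaIntegral_scaled (a : ℂ) (b : ℂ) ht
  rw [Complex.betaIntegral_eq_Gamma_mul_div _ _ (by simpa using ha) (by simpa using hb)] at h
  have h2 : ∫ x in (0 : ℝ)..t, (x : ℂ) ^ ((a : ℂ) - 1) * ((t : ℂ) - x) ^ ((b : ℂ) - 1) =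
      ((∫ ξ in (0 : ℝ)..t, ξ ^ (a - 1) * (t - ξ) ^ (b - 1) : ℝ) : ℂ) := by
    rw [← intervalIntegral.integral_ofReal]
    refine intervalIntegral.integral_congr fun x hx => ?_
    rw [uIcc_of_le ht.le] at hx
    have h1 : 0 ≤ t - x := by linarith [hx.2]
    simp only [Complex.ofReal_mul, Complex.ofReal_cpow hx.1, Complex.ofReal_cpow h1,
      Complex.ofReal_sub, Complex.ofReal_one]
  rw [h2] at h
  have h3 : ((t : ℂ) ^ ((a : ℂ) + b - 1)) = ((t ^ (a + b - 1) : ℝ) : ℂ) := by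
    rw [Complex.ofReal_cpow ht.le]; push_cast; rfl
  rw [h3, ← Complex.ofReal_add, Complex.Gamma_ofReal, Complex.Gamma_ofReal,
    Complex.Gamma_ofReal] at h
  have h4 : ∫ ξ in (0 : ℝ)..t, ξ ^ (a - 1) * (t - ξ) ^ (b - 1) =
    t ^ (a + b - 1) * (Real.Gamma a * Real.Gamma b / Real.Gamma (a + b)) := by exact_mod_cast h
  rw [h4, mul_comm]

/-- The integrand is integrable because its integral has a nonzero value. -/
theorem intervalIntegrable_beta_scaled {a b t : ℝ} (ha : 0 < a) (hb : 0 < b) (ht : 0 < t) :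
    IntervalIntegrable (fun ξ : ℝ => ξ ^ (a - 1) * (t - ξ) ^ (b - 1)) volume 0 t := by
  by_contra hn
  have h := integral_beta_scaled ha hb ht
  rw [intervalIntegral.integral_undef hn] at h
  have h1 := Real.Gamma_pos_of_pos ha
  have h2 := Real.Gamma_pos_of_pos hb
  have h3 := Real.Gamma_pos_of_pos (add_pos ha hb)
  have : 0 < Real.Gamma a * Real.Gamma b / Real.Gamma (a + b) * t ^ (a + b - 1) := by positivity
  exact this.ne h

/-- On `[0, t]` the kernel of `∂_t^(ρ - 1)` is `(t - ξ) ^ ((1 - ρ) - 1)`; at the end point `ξ = t`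
this is an identity between the values assigned to division by zero and to powers of zero. -/
theorem div_rpow_eq_mul_rpow {ρ t ξ : ℝ} (c : ℝ) (hξ : ξ ≤ t) :
    c / (t - ξ) ^ (ρ - 1 + 1) = c * (t - ξ) ^ ((1 - ρ) - 1) := by
  rw [show (1 - ρ) - 1 = -ρ by ring, show ρ - 1 + 1 = ρ by ring,
    Real.rpow_neg (by linarith), div_eq_mul_inv]

theorem intervalIntegrable_rpow_div {a ρ t : ℝ} (ha : 0 < a) (hρ : ρ < 1) (ht : 0 < t) :
    IntervalIntegrable (fun ξ : ℝ => ξ ^ (a - 1) / (t - ξ) ^ (ρ - 1 + 1)) volume 0 t := by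
  refine (intervalIntegrable_beta_scaled ha (sub_pos.2 hρ) ht).congr fun ξ hξ => ?_
  rw [uIoc_of_le ht.le] at hξ
  exact (div_rpow_eq_mul_rpow _ hξ.2).symm

theorem integral_rpow_div {a ρ t : ℝ} (ha : 0 < a) (hρ : ρ < 1) (ht : 0 < t) :
    ∫ ξ in (0 : ℝ)..t, ξ ^ (a - 1) / (t - ξ) ^ (ρ - 1 + 1) =
      Real.Gamma a * Real.Gamma (1 - ρ) / Real.Gamma (a + (1 - ρ)) * t ^ (a - ρ) := by
  rw [show a - ρ = a + (1 - ρ) - 1 by ring, ← integral_beta_scaled ha (sub_pos.2 hρ) ht]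
  refine intervalIntegral.integral_congr fun ξ hξ => ?_
  rw [uIcc_of_le ht.le] at hξ
  exact div_rpow_eq_mul_rpow _ hξ.2

/-- `Γ(x)` outgrows every geometric progression. -/
theorem rpow_mul_exp_le_Gamma {A x : ℝ} (hA : 0 < A) (hx : 1 ≤ x) :
    A ^ (x - 1) * Real.exp (-A) ≤ Real.Gamma x := by
  have hx0 : 0 < x := by linarith
  have hsub : Ioi A ⊆ Ioi (0 : ℝ) := Ioi_subset_Ioi hA.le
  have hi := Real.GammaIntegral_convergent hx0
  calc A ^ (x - 1) * Real.exp (-A) = ∫ t in Ioi A, Real.exp (-t) * A ^ (x - 1) := by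
        rw [integral_mul_const, integral_exp_neg_Ioi, mul_comm]
    _ ≤ ∫ t in Ioi A, Real.exp (-t) * t ^ (x - 1) := by
        refine setIntegral_mono_on ((integrableOn_exp_neg_Ioi A).mul_const _)
          (hi.mono_set hsub) measurableSet_Ioi fun t ht => ?_
        exact mul_le_mul_of_nonneg_left
          (Real.rpow_le_rpow hA.le (le_of_lt ht) (by linarith)) (Real.exp_pos _).le
    _ ≤ ∫ t in Ioi (0 : ℝ), Real.exp (-t) * t ^ (x - 1) := by
        refine setIntegral_mono_set hi ?_ hsub.eventuallyLE
        filter_upwards [ae_restrict_mem measurableSet_Ioi] with t ht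
        exact mul_nonneg (Real.exp_pos _).le (Real.rpow_nonneg (le_of_lt ht) _)
    _ = Real.Gamma x := (Real.Gamma_eq_integral hx0).symm

/-! ### The Mittag-Leffler series -/

theorem Gamma_mul_natCast_add_pos {ρ μ : ℝ} (hρ : 0 < ρ) (hμ : 0 < μ) (k : ℕ) :
    0 < Real.Gamma (ρ * k + μ) := Real.Gamma_pos_of_pos (by positivity)

theorem summable_pow_div_Gamma {ρ μ : ℝ} (hρ : 0 < ρ) (hμ : 0 < μ) (z : ℝ) :
    Summable fun k : ℕ => z ^ k / Real.Gamma (ρ * k + μ) := by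
  -- `A` is chosen such that `|z| / A ^ ρ ≤ 1 / 2`
  set B : ℝ := 2 * |z| + 1 with hB
  have hBpos : 0 < B := by positivity
  set A : ℝ := B ^ (1 / ρ) with hA
  have hApos : 0 < A := Real.rpow_pos_of_pos hBpos _
  have hAρ : A ^ ρ = B := by
    rw [hA, ← Real.rpow_mul hBpos.le, one_div, inv_mul_cancel₀ hρ.ne', Real.rpow_one]
  have hgeo : Summable fun k : ℕ => (|z| / B) ^ k * (A ^ (1 - μ) * Real.exp A) := by
    refine (summable_geometric_of_lt_one (by positivity) ?_).mul_right _
    rw [div_lt_one hBpos, hB]; linarith [abs_nonneg z]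
  refine hgeo.of_norm_bounded_eventually_nat ?_
  have hev : ∀ᶠ k : ℕ in atTop, 1 / ρ ≤ (k : ℝ) :=
    tendsto_natCast_atTop_atTop.eventually_ge_atTop _
  filter_upwards [hev] with k hk
  have h1 : 1 ≤ ρ * k + μ := by
    have : ρ * (1 / ρ) ≤ ρ * k := mul_le_mul_of_nonneg_left hk hρ.le
    rw [mul_one_div_cancel hρ.ne'] at this
    linarith
  have h2 := rpow_mul_exp_le_Gamma hApos h1
  have hG := Gamma_mul_natCast_add_pos hρ hμ k
  rw [norm_div, norm_pow, Real.norm_eq_abs, Real.norm_of_nonneg hG.le, div_le_iff₀ hG]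
  have h3 : A ^ (ρ * k + μ - 1) = B ^ k * A ^ (μ - 1) := by
    rw [show ρ * k + μ - 1 = ρ * k + (μ - 1) by ring, Real.rpow_add hApos, Real.rpow_mul hApos.le,
      hAρ, Real.rpow_natCast]
  have h4 : A ^ (1 - μ) * A ^ (μ - 1) = 1 := by
    rw [← Real.rpow_add hApos]; simp
  have h5 : Real.exp A * Real.exp (-A) = 1 := by rw [← Real.exp_add]; simp
  calc |z| ^ k = (|z| / B) ^ k * (A ^ (1 - μ) * Real.exp A) *
        (A ^ (ρ * k + μ - 1) * Real.exp (-A)) := by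
        rw [h3, div_pow]
        have hB0 : B ^ k ≠ 0 := by positivity
        calc |z| ^ k = |z| ^ k / B ^ k * B ^ k * (A ^ (1 - μ) * A ^ (μ - 1)) *
            (Real.exp A * Real.exp (-A)) := by rw [h4, h5]; field_simp
          _ = _ := by ring
    _ ≤ _ := by gcongr

theorem hasSum_mittagLeffler {ρ μ : ℝ} (hρ : 0 < ρ) (hμ : 0 < μ) (z : ℝ) :
    HasSum (fun k : ℕ => z ^ k / Real.Gamma (ρ * k + μ)) (mittagLeffler ρ μ z) :=
  (summable_pow_div_Gamma hρ hμ z).hasSum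

theorem mittagLeffler_zero (ρ μ : ℝ) : mittagLeffler ρ μ 0 = 1 / Real.Gamma μ := by
  rw [mittagLeffler, tsum_eq_single 0]
  · simp
  · intro k hk
    simp [hk]

theorem hasDerivAt_mittagLeffler {ρ μ : ℝ} (hρ : 0 < ρ) (hμ : 0 < μ) (z : ℝ) :
    HasDerivAt (mittagLeffler ρ μ)
      (∑' k : ℕ, (k : ℝ) * z ^ (k - 1) / Real.Gamma (ρ * k + μ)) z := by
  set R : ℝ := |z| + 1 with hR
  have hR1 : 1 ≤ R := by rw [hR]; linarith [abs_nonneg z]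
  -- `k R ^ (k - 1) ≤ (2 R) ^ k`
  refine hasDerivAt_tsum_of_isPreconnected (t := Metric.ball 0 R) (y₀ := z)
    (g := fun (k : ℕ) (w : ℝ) => w ^ k / Real.Gamma (ρ * k + μ))
    (g' := fun (k : ℕ) (w : ℝ) => (k : ℝ) * w ^ (k - 1) / Real.Gamma (ρ * k + μ))
    (summable_pow_div_Gamma hρ hμ (2 * R)) Metric.isOpen_ball
    (convex_ball _ _).isPreconnected ?_ ?_ ?_ (summable_pow_div_Gamma hρ hμ z) ?_
  · intro k w _
    exact (hasDerivAt_pow k w).div_const _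
  · intro k w hw
    have hG := Gamma_mul_natCast_add_pos hρ hμ k
    have hw' : |w| ≤ R := by simpa using (mem_ball_zero_iff.1 hw).le
    rw [norm_div, norm_mul, norm_pow, Real.norm_of_nonneg hG.le, Real.norm_eq_abs w,
      Real.norm_of_nonneg (Nat.cast_nonneg k), mul_pow]
    gcongr
    · exact_mod_cast Nat.lt_two_pow_self.le
    · calc |w| ^ (k - 1) ≤ R ^ (k - 1) := by gcongr
        _ ≤ R ^ k := pow_le_pow_right₀ hR1 (Nat.sub_le _ _)
  · simp [hR]
  · simp [hR]

theorem continuous_mittagLeffler {ρ μ : ℝ} (hρ : 0 < ρ) (hμ : 0 < μ) :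
    Continuous (mittagLeffler ρ μ) :=
  continuous_iff_continuousAt.2 fun z => (hasDerivAt_mittagLeffler hρ hμ z).continuousAt

theorem hasDerivAt_mittagLeffler_one {ρ : ℝ} (hρ : 0 < ρ) (z : ℝ) :
    HasDerivAt (mittagLeffler ρ 1) (mittagLeffler ρ ρ z / ρ) z := by
  convert hasDerivAt_mittagLeffler hρ one_pos z using 1
  have h : HasSum (fun k : ℕ => ((k + 1 : ℕ) : ℝ) * z ^ (k + 1 - 1) /
      Real.Gamma (ρ * (k + 1 : ℕ) + 1)) (mittagLeffler ρ ρ z / ρ) := by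
    refine ((hasSum_mittagLeffler hρ hρ z).div_const ρ).congr_fun fun k => ?_
    have hk : (0 : ℝ) < (k : ℝ) + 1 := by positivity
    have hG := (Gamma_mul_natCast_add_pos hρ hρ k).ne'
    rw [Real.Gamma_add_one (by push_cast; positivity)]
    push_cast
    rw [show ρ * ((k : ℝ) + 1) = ρ * k + ρ by ring]
    have : ρ * (k : ℝ) + ρ ≠ 0 := by positivity
    field_simp
  have h2 := (hasSum_nat_add_iff (f := fun k : ℕ => (k : ℝ) * z ^ (k - 1) /
    Real.Gamma (ρ * k + 1)) 1).1 h
  simpa using h2.tsum_eq.symm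

/-! ### The fundamental solution of the fractional relaxation equation -/

/-- The fundamental solution `r(t) = t ^ (ρ - 1) E_{ρ,ρ}(-l t ^ ρ)` of the relaxation equation
`∂_t^ρ r = -l r`. -/
noncomputable def relaxation (ρ l t : ℝ) : ℝ :=
  t ^ (ρ - 1) * mittagLeffler ρ ρ (-l * t ^ ρ)

theorem hasSum_relaxation {ρ t : ℝ} (hρ : 0 < ρ) (l : ℝ) (ht : 0 < t) :
    HasSum (fun k : ℕ => (-l) ^ k / Real.Gamma (ρ * k + ρ) * t ^ (ρ * k + ρ - 1))
      (relaxation ρ l t) := by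
  refine ((hasSum_mittagLeffler hρ hρ (-l * t ^ ρ)).mul_left (t ^ (ρ - 1))).congr_fun fun k => ?_
  rw [mul_pow, show ρ * k + ρ - 1 = (ρ - 1) + ρ * k by ring, Real.rpow_add ht,
    Real.rpow_mul ht.le, Real.rpow_natCast]
  ring

theorem continuousOn_relaxation {ρ : ℝ} (hρ : 0 < ρ) (l : ℝ) :
    ContinuousOn (relaxation ρ l) (Ioi 0) := by
  intro t ht
  refine ContinuousAt.continuousWithinAt ?_
  have h1 : ContinuousAt (fun t : ℝ => t ^ ρ) t := Real.continuousAt_rpow_const _ _ (Or.inr hρ.le)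
  exact (Real.continuousAt_rpow_const _ _ (Or.inl (ne_of_gt ht))).mul
    ((continuous_mittagLeffler hρ hρ).continuousAt.comp (h1.const_mul _))

theorem hasDerivAt_mittagLeffler_one_comp {ρ t : ℝ} (hρ : 0 < ρ) (l : ℝ) (ht : 0 < t) :
    HasDerivAt (fun s => mittagLeffler ρ 1 (-l * s ^ ρ)) (-l * relaxation ρ l t) t := by
  have h1 : HasDerivAt (fun s : ℝ => -l * s ^ ρ) (-l * (ρ * t ^ (ρ - 1))) t :=
    (Real.hasDerivAt_rpow_const (Or.inl ht.ne')).const_mul _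
  refine ((hasDerivAt_mittagLeffler_one hρ (-l * t ^ ρ)).comp t h1).congr_deriv ?_
  rw [relaxation]; field_simp

theorem differentiableAt_relaxation {ρ t : ℝ} (hρ : 0 < ρ) (l : ℝ) (ht : 0 < t) :
    DifferentiableAt ℝ (relaxation ρ l) t := by
  have h1 : DifferentiableAt ℝ (fun s : ℝ => -l * s ^ ρ) t :=
    (Real.differentiableAt_rpow_const_of_ne _ ht.ne').const_mul _
  exact (Real.differentiableAt_rpow_const_of_ne _ ht.ne').mul
    ((hasDerivAt_mittagLeffler hρ hρ _).differentiableAt.comp t h1)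

/-- A function that is continuous on `(0, ∞)` and `O(ξ ^ (ρ - 1))` on `(0, t]` has a fractional
integral of order `1 - ρ` at `t`. -/
theorem rlIntegrable_of_continuousOn_of_le {ρ t C : ℝ} {f : ℝ → ℝ} (hρ : ρ ∈ Ioo (0 : ℝ) 1)
    (ht : 0 < t) (hf : ContinuousOn f (Ioi 0)) (hC : ∀ ξ ∈ Ioc 0 t, |f ξ| ≤ C * ξ ^ (ρ - 1)) :
    RLIntegrable (ρ - 1) f t := by
  rw [RLIntegrable, intervalIntegrable_iff_integrableOn_Ioc_of_le ht.le]
  have hint := ((intervalIntegrable_iff_integrableOn_Ioc_of_le ht.le).1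
    (intervalIntegrable_rpow_div hρ.1 hρ.2 ht)).const_mul C
  refine hint.mono' ?_ ?_
  · refine (AEMeasurable.div ?_ ?_).aestronglyMeasurable
    · exact (hf.mono Ioc_subset_Ioi_self).aemeasurable measurableSet_Ioc
    · exact (by fun_prop : Measurable fun ξ : ℝ => (t - ξ) ^ (ρ - 1 + 1)).aemeasurable
  · filter_upwards [ae_restrict_mem measurableSet_Ioc] with ξ hξ
    have e2 : 0 ≤ (t - ξ) ^ (ρ - 1 + 1) := Real.rpow_nonneg (by linarith [hξ.2]) _
    rw [norm_div, Real.norm_eq_abs, Real.norm_of_nonneg e2, ← mul_div_assoc]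
    exact div_le_div_of_nonneg_right (hC ξ hξ) e2

theorem rlIntegrable_relaxation {ρ t : ℝ} (hρ : ρ ∈ Ioo (0 : ℝ) 1) (l : ℝ) (ht : 0 < t) :
    RLIntegrable (ρ - 1) (relaxation ρ l) t := by
  have hc : ContinuousOn (fun ξ : ℝ => mittagLeffler ρ ρ (-l * ξ ^ ρ)) (Icc 0 t) :=
    ((continuous_mittagLeffler hρ.1 hρ.1).comp
      (continuous_const.mul (Real.continuous_rpow_const hρ.1.le))).continuousOn
  obtain ⟨C, hC⟩ := (isCompact_Icc (a := (0 : ℝ)) (b := t)).exists_bound_of_continuousOn hc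
  refine rlIntegrable_of_continuousOn_of_le (C := C) hρ ht (continuousOn_relaxation hρ.1 l) ?_
  intro ξ hξ
  rw [relaxation, abs_mul, abs_of_nonneg (Real.rpow_nonneg hξ.1.le _), mul_comm]
  exact mul_le_mul_of_nonneg_right (hC ξ ⟨hξ.1.le, hξ.2⟩) (Real.rpow_nonneg hξ.1.le _)

/-- Termwise integration of the series of `relaxation ρ l` with the Beta integral. -/
theorem hasSum_integral_relaxation {ρ t : ℝ} (hρ : ρ ∈ Ioo (0 : ℝ) 1) (l : ℝ) (ht : 0 < t) :
    HasSum (fun k : ℕ => Real.Gamma (1 - ρ) * ((-l * t ^ ρ) ^ k / Real.Gamma (ρ * k + 1)))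
      (∫ ξ in Ioc 0 t, relaxation ρ l ξ / (t - ξ) ^ (ρ - 1 + 1)) := by
  obtain ⟨h0, h1⟩ := hρ
  have hpos : ∀ k : ℕ, 0 < ρ * k + ρ := fun k => by positivity
  have hval : ∀ (m : ℝ) (k : ℕ), m ^ k / Real.Gamma (ρ * k + ρ) *
      (Real.Gamma (ρ * k + ρ) * Real.Gamma (1 - ρ) / Real.Gamma (ρ * k + ρ + (1 - ρ)) *
        t ^ (ρ * k + ρ - ρ)) =
      Real.Gamma (1 - ρ) * ((m * t ^ ρ) ^ k / Real.Gamma (ρ * k + 1)) := by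
    intro m k
    have := (Gamma_mul_natCast_add_pos h0 h0 k).ne'
    rw [show ρ * k + ρ + (1 - ρ) = ρ * k + 1 by ring, show ρ * k + ρ - ρ = ρ * k by ring,
      Real.rpow_mul ht.le, Real.rpow_natCast, mul_pow]
    field_simp
  let F : ℕ → ℝ → ℝ := fun k ξ =>
    (-l) ^ k / Real.Gamma (ρ * k + ρ) * (ξ ^ (ρ * k + ρ - 1) / (t - ξ) ^ (ρ - 1 + 1))
  have hFint : ∀ k, IntegrableOn (F k) (Ioc 0 t) := fun k =>
    ((intervalIntegrable_iff_integrableOn_Ioc_of_le ht.le).1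
      (intervalIntegrable_rpow_div (hpos k) h1 ht)).const_mul _
  have hFval : ∀ k, ∫ ξ in Ioc 0 t, F k ξ =
      Real.Gamma (1 - ρ) * ((-l * t ^ ρ) ^ k / Real.Gamma (ρ * k + 1)) := fun k => by
    rw [← hval, ← integral_rpow_div (hpos k) h1 ht, intervalIntegral.integral_of_le ht.le,
      integral_const_mul]
  have hFnorm : ∀ k, ∫ ξ in Ioc 0 t, ‖F k ξ‖ =
      Real.Gamma (1 - ρ) * ((|l| * t ^ ρ) ^ k / Real.Gamma (ρ * k + 1)) := fun k => by
    rw [← hval, ← integral_rpow_div (hpos k) h1 ht, intervalIntegral.integral_of_le ht.le,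
      ← integral_const_mul]
    refine setIntegral_congr_fun measurableSet_Ioc fun ξ hξ => ?_
    have e1 : 0 ≤ ξ ^ (ρ * k + ρ - 1) := Real.rpow_nonneg hξ.1.le _
    have e2 : 0 ≤ (t - ξ) ^ (ρ - 1 + 1) := Real.rpow_nonneg (by linarith [hξ.2]) _
    simp only [F, norm_mul, norm_div, norm_pow, norm_neg, Real.norm_eq_abs, abs_of_nonneg e1,
      abs_of_nonneg e2, abs_of_pos (Gamma_mul_natCast_add_pos h0 h0 k)]
  have hsum : Summable fun k => ∫ ξ in Ioc 0 t, ‖F k ξ‖ := by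
    simp_rw [hFnorm]
    exact (summable_pow_div_Gamma h0 one_pos _).mul_left _
  have htsum : ∀ ξ ∈ Ioc 0 t, ∑' k, F k ξ = relaxation ρ l ξ / (t - ξ) ^ (ρ - 1 + 1) := by
    intro ξ hξ
    rw [← ((hasSum_relaxation h0 l hξ.1).div_const _).tsum_eq]
    exact tsum_congr fun k => by simp only [F]; ring
  have := hasSum_integral_of_summable_integral_norm hFint hsum
  simp_rw [hFval] at this
  rwa [setIntegral_congr_fun measurableSet_Ioc htsum] at this

theorem rlIntegral_relaxation {ρ t : ℝ} (hρ : ρ ∈ Ioo (0 : ℝ) 1) (l : ℝ) (ht : 0 < t) :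
    rlIntegral (ρ - 1) (relaxation ρ l) t = mittagLeffler ρ 1 (-l * t ^ ρ) := by
  have hG := (Real.Gamma_pos_of_pos (sub_pos.2 hρ.2)).ne'
  rw [rlIntegral, intervalIntegral.integral_of_le ht.le,
    ← (hasSum_integral_relaxation hρ l ht).tsum_eq, tsum_mul_left, neg_sub, ← mul_assoc,
    one_div, inv_mul_cancel₀ hG, one_mul, mittagLeffler]

theorem hasDerivAt_rlIntegral_relaxation {ρ t : ℝ} (hρ : ρ ∈ Ioo (0 : ℝ) 1) (l : ℝ) (ht : 0 < t) :
    HasDerivAt (rlIntegral (ρ - 1) (relaxation ρ l)) (-l * relaxation ρ l t) t := by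
  refine (hasDerivAt_mittagLeffler_one_comp hρ.1 l ht).congr_of_eventuallyEq ?_
  filter_upwards [Ioi_mem_nhds ht] with s hs
  exact rlIntegral_relaxation hρ l hs

/-! ### A maximum principle for the fractional derivative -/

theorem RLIntegrable.intervalIntegrable {ρ t : ℝ} {f : ℝ → ℝ} (hρ : 0 < ρ) (ht : 0 ≤ t)
    (hf : RLIntegrable (ρ - 1) f t) : IntervalIntegrable f volume 0 t := by
  have hc : Continuous fun ξ : ℝ => (t - ξ) ^ (ρ - 1 + 1) := by
    rw [sub_add_cancel]
    exact (Real.continuous_rpow_const hρ.le).comp (by fun_prop)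
  have h := hf.mul_continuousOn hc.continuousOn
  rw [intervalIntegrable_iff_integrableOn_Ioo_of_le ht] at h ⊢
  refine h.congr_fun (fun ξ hξ => ?_) measurableSet_Ioo
  have : 0 < (t - ξ) ^ (ρ - 1 + 1) := Real.rpow_pos_of_pos (by linarith [hξ.2]) _
  exact div_mul_cancel₀ _ this.ne'

theorem rlIntegral_sub {α t : ℝ} {f g : ℝ → ℝ} (hf : RLIntegrable α f t)
    (hg : RLIntegrable α g t) :
    rlIntegral α (fun s => f s - g s) t =
      rlIntegral α f t - rlIntegral α g t := by
  simp only [rlIntegral, sub_div]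
  rw [intervalIntegral.integral_sub hf hg, mul_sub]

theorem RLIntegrable.sub {α t : ℝ} {f g : ℝ → ℝ} (hf : RLIntegrable α f t)
    (hg : RLIntegrable α g t) : RLIntegrable α (fun s => f s - g s) t := by
  simp only [RLIntegrable, sub_div] at *
  exact IntervalIntegrable.sub hf hg

theorem rlIntegral_nonneg {ρ t : ℝ} {f : ℝ → ℝ} (hρ : ρ < 1) (ht : 0 < t)
    (hf : ∀ s ∈ Ioc 0 t, 0 ≤ f s) : 0 ≤ rlIntegral (ρ - 1) f t := by
  have hG : 0 < Real.Gamma (-(ρ - 1)) := Real.Gamma_pos_of_pos (by linarith)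
  rw [rlIntegral, intervalIntegral.integral_of_le ht.le]
  refine mul_nonneg (by positivity) (setIntegral_nonneg measurableSet_Ioc fun s hs => ?_)
  exact div_nonneg (hf s hs) (Real.rpow_nonneg (by linarith [hs.2]) _)

/-- The kernel `x ^ (-ρ)` decreases at least linearly: the tangent line inequality. -/
theorem inv_rpow_sub_ge {ρ x y : ℝ} (hρ : ρ ∈ Ioo (0 : ℝ) 1) (hx : 0 < x) (hxy : x ≤ y) :
    ρ * (y - x) / (y * y ^ ρ) ≤ 1 / x ^ ρ - 1 / y ^ ρ := by
  have hy : 0 < y := hx.trans_le hxy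
  have hxρ := Real.rpow_pos_of_pos hx ρ
  have hyρ := Real.rpow_pos_of_pos hy ρ
  have hB : (x / y) ^ ρ ≤ 1 + ρ * (x / y - 1) := by
    have := rpow_one_add_le_one_add_mul_self (s := x / y - 1)
      (by linarith [div_pos hx hy]) hρ.1.le hρ.2.le
    simpa using this
  rw [Real.div_rpow hx.le hy.le] at hB
  have h1 : x ^ ρ ≤ y ^ ρ := Real.rpow_le_rpow hx.le hxy hρ.1.le
  have h2 : ρ * (1 - x / y) ≤ (y ^ ρ - x ^ ρ) / y ^ ρ := by
    rw [sub_div, div_self hyρ.ne']; linarith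
  have h3 : 0 ≤ (y ^ ρ - x ^ ρ) / y ^ ρ := div_nonneg (by linarith) hyρ.le
  calc ρ * (y - x) / (y * y ^ ρ) = ρ * (1 - x / y) / y ^ ρ := by field_simp
    _ ≤ (y ^ ρ - x ^ ρ) / y ^ ρ / y ^ ρ := by gcongr
    _ ≤ (y ^ ρ - x ^ ρ) / y ^ ρ / x ^ ρ := by gcongr
    _ = 1 / x ^ ρ - 1 / y ^ ρ := by field_simp

/-- At a first zero `T` of a function that is positive on `(0, T)`, the fractional derivative is
negative: the kernel `(T - s) ^ (-ρ)` strictly decreases in `T` while nothing is added near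
`s = T`, because `f` vanishes there to first order. -/
theorem deriv_rlIntegral_neg_of_first_zero {ρ T D : ℝ} {f : ℝ → ℝ} (hρ : ρ ∈ Ioo (0 : ℝ) 1)
    (hT : 0 < T) (hint : ∀ t > 0, RLIntegrable (ρ - 1) f t) (hpos : ∀ t ∈ Ioo 0 T, 0 < f t)
    (hzero : f T = 0) (hdiff : DifferentiableAt ℝ f T)
    (hD : HasDerivAt (rlIntegral (ρ - 1) f) D T) : D < 0 := by
  obtain ⟨h0, h1⟩ := hρ
  have hG : 0 < Real.Gamma (-(ρ - 1)) := Real.Gamma_pos_of_pos (by linarith)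
  set G := Real.Gamma (-(ρ - 1)) with hGdef
  set Φ : ℝ → ℝ := fun t => ∫ s in (0 : ℝ)..t, f s / (t - s) ^ (ρ - 1 + 1) with hΦ
  have hΦD : HasDerivAt Φ (G * D) T := by
    refine (hD.const_mul G).congr_of_eventuallyEq (Eventually.of_forall fun t => ?_)
    simp only [hΦ, rlIntegral]
    rw [← hGdef]
    field_simp
  obtain ⟨L, hL⟩ := hdiff.hasDerivAt.isBigO_sub.bound
  obtain ⟨δ, hδ, hδL⟩ := Metric.eventually_nhds_iff.1 hL
  have hLpos : 0 ≤ |L| := abs_nonneg L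
  have hfint : ∀ t > 0, IntervalIntegrable f volume 0 t := fun t ht =>
    (hint t ht).intervalIntegrable h0 ht.le
  set c : ℝ := ρ / (T * T ^ ρ) * ∫ s in (0 : ℝ)..(T / 2), f s with hc
  have hTρ := Real.rpow_pos_of_pos hT ρ
  have hcpos : 0 < c := by
    refine mul_pos (by positivity) ?_
    refine intervalIntegral.intervalIntegral_pos_of_pos_on (hfint _ (by positivity)) ?_
      (by positivity)
    exact fun s hs => hpos s ⟨hs.1, by linarith [hs.2]⟩
  have key : ∀ h, 0 < h → h < δ → h < T / 2 → Φ T ≤ Φ (T - h) - h * c + h * (|L| * h ^ (1 - ρ)) := by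
    intro h hh hhδ hhT
    have hTh : 0 < T - h := by linarith
    have i1 : IntervalIntegrable (fun s => f s / (T - s) ^ (ρ - 1 + 1)) volume 0 (T - h) :=
      IntervalIntegrable.mono_set (hint T hT) (by
        rw [uIcc_of_le hTh.le, uIcc_of_le hT.le]; exact Icc_subset_Icc_right (by linarith))
    have i2 : IntervalIntegrable (fun s => f s / (T - s) ^ (ρ - 1 + 1)) volume (T - h) T :=
      IntervalIntegrable.mono_set (hint T hT) (by
        rw [uIcc_of_le (by linarith), uIcc_of_le hT.le]; exact Icc_subset_Icc_left hTh.le)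
    have hsplit : Φ T = (∫ s in (0 : ℝ)..(T - h), f s / (T - s) ^ (ρ - 1 + 1)) +
        ∫ s in (T - h)..T, f s / (T - s) ^ (ρ - 1 + 1) :=
      (intervalIntegral.integral_add_adjacent_intervals i1 i2).symm
    have hA : (∫ s in (0 : ℝ)..(T - h), f s / (T - s) ^ (ρ - 1 + 1)) ≤
        ∫ s in (0 : ℝ)..(T - h), (f s / (T - h - s) ^ (ρ - 1 + 1) - h * (ρ / (T * T ^ ρ)) * f s) := by
      refine intervalIntegral.integral_mono_on_of_le_Ioo hTh.le i1
        (IntervalIntegrable.sub (hint _ hTh) ((hfint _ hTh).const_mul _)) fun s hs => ?_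
      have hfs := hpos s ⟨hs.1, by linarith [hs.2]⟩
      have hk := inv_rpow_sub_ge ⟨h0, h1⟩ (by linarith [hs.2] : 0 < T - h - s)
        (by linarith : T - h - s ≤ T - s)
      have hTs : 0 < T - s := by linarith [hs.2]
      have hTsT : T - s ≤ T := by linarith [hs.1]
      have hTsρ := Real.rpow_pos_of_pos hTs ρ
      have hk2 : h * (ρ / (T * T ^ ρ)) ≤ ρ * (T - s - (T - h - s)) / ((T - s) * (T - s) ^ ρ) := by
        rw [show ρ * (T - s - (T - h - s)) / ((T - s) * (T - s) ^ ρ) =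
          h * (ρ / ((T - s) * (T - s) ^ ρ)) by ring]
        gcongr
      rw [sub_add_cancel]
      have := mul_le_mul_of_nonneg_left (hk2.trans hk) hfs.le
      rw [div_eq_mul_one_div, div_eq_mul_one_div (f s) ((T - h - s) ^ ρ)]
      linarith
    have hA2 : (∫ s in (0 : ℝ)..(T - h),
        (f s / (T - h - s) ^ (ρ - 1 + 1) - h * (ρ / (T * T ^ ρ)) * f s)) ≤ Φ (T - h) - h * c := by
      rw [intervalIntegral.integral_sub (hint _ hTh) ((hfint _ hTh).const_mul _),
        intervalIntegral.integral_const_mul, mul_assoc, hc]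
      have : ∫ s in (0 : ℝ)..(T / 2), f s ≤ ∫ s in (0 : ℝ)..(T - h), f s := by
        refine intervalIntegral.integral_mono_interval le_rfl (by positivity) (by linarith) ?_
          (hfint _ hTh)
        filter_upwards [ae_restrict_mem measurableSet_Ioc] with s hs
        exact (hpos s ⟨hs.1, by linarith [hs.2]⟩).le
      have h' : 0 ≤ h * (ρ / (T * T ^ ρ)) := by positivity
      have := mul_le_mul_of_nonneg_left this h'
      simp only [hΦ]
      linarith
    have hB : ∫ s in (T - h)..T, f s / (T - s) ^ (ρ - 1 + 1) ≤ h * (|L| * h ^ (1 - ρ)) := by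
      have : ∫ s in (T - h)..T, f s / (T - s) ^ (ρ - 1 + 1) ≤
          ∫ _ in (T - h)..T, |L| * h ^ (1 - ρ) := by
        refine intervalIntegral.integral_mono_on_of_le_Ioo (by linarith) i2 (by simp) fun s hs => ?_
        have hTs : 0 < T - s := by linarith [hs.2]
        have hTsρ := Real.rpow_pos_of_pos hTs ρ
        have hb := hδL (y := s) (by
          rw [Real.dist_eq, abs_sub_lt_iff]; constructor <;> linarith [hs.1, hs.2])
        rw [hzero, sub_zero, Real.norm_eq_abs, Real.norm_eq_abs, abs_sub_comm, abs_of_pos hTs] at hb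
        have hb2 : f s ≤ |L| * (T - s) := (le_abs_self _).trans (hb.trans
          (mul_le_mul_of_nonneg_right (le_abs_self L) hTs.le))
        rw [sub_add_cancel, div_le_iff₀ hTsρ]
        have e1 : (T - s) ^ (1 - ρ) * (T - s) ^ ρ = T - s := by
          rw [← Real.rpow_add hTs]; simp
        have e2 : (T - s) ^ (1 - ρ) ≤ h ^ (1 - ρ) :=
          Real.rpow_le_rpow hTs.le (by linarith [hs.1]) (by linarith)
        calc f s ≤ |L| * ((T - s) ^ (1 - ρ) * (T - s) ^ ρ) := by rw [e1]; exact hb2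
          _ ≤ |L| * (h ^ (1 - ρ) * (T - s) ^ ρ) := by gcongr
          _ = _ := by ring
      refine this.trans_eq ?_
      rw [intervalIntegral.integral_const, smul_eq_mul]
      ring
    linarith
  have hlim := hΦD.tendsto_slope_zero_left
  have hlim2 : Tendsto (fun t : ℝ => -c + |L| * (-t) ^ (1 - ρ)) (𝓝[<] 0) (𝓝 (-c + |L| * 0)) := by
    have hcont : Continuous fun t : ℝ => (-t) ^ (1 - ρ) :=
      (Real.continuous_rpow_const (by linarith)).comp continuous_neg
    have := hcont.tendsto 0
    rw [neg_zero, Real.zero_rpow (by linarith)] at this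
    exact tendsto_const_nhds.add ((this.mono_left nhdsWithin_le_nhds).const_mul _)
  have hle : G * D ≤ -c + |L| * 0 := by
    refine le_of_tendsto_of_tendsto hlim hlim2 ?_
    have hm : Ioo (-(min δ (T / 2))) 0 ∈ 𝓝[<] (0 : ℝ) :=
      Ioo_mem_nhdsLT (by simp only [neg_lt_zero]; positivity)
    filter_upwards [hm] with t ht
    have ht1 : -t < δ := by linarith [ht.1, min_le_left δ (T / 2)]
    have ht2 : -t < T / 2 := by linarith [ht.1, min_le_right δ (T / 2)]
    have ht3 : 0 < -t := by linarith [ht.2]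
    have hk := key (-t) ht3 ht1 ht2
    rw [sub_neg_eq_add] at hk
    rw [smul_eq_mul, inv_mul_eq_div, div_le_iff_of_neg ht.2]
    linarith
  by_contra hn
  have : 0 ≤ G * D := mul_nonneg hG.le (not_lt.1 hn)
  linarith

theorem exists_first_zero {f : ℝ → ℝ} (hf : ContinuousOn f (Ioi 0))
    (h0 : ∀ᶠ t in 𝓝[>] 0, 0 < f t) {b : ℝ} (hb : 0 < b) (hfb : f b ≤ 0) :
    ∃ T > 0, f T = 0 ∧ ∀ t ∈ Ioo 0 T, 0 < f t := by
  obtain ⟨ε, hε, hpos⟩ := mem_nhdsGT_iff_exists_Ioo_subset.1 h0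
  have hε : 0 < ε := hε
  set S : Set ℝ := Ici ε ∩ f ⁻¹' Iic 0 with hS
  have hmem : ∀ z, 0 < z → f z ≤ 0 → z ∈ S := by
    refine fun z hz hfz => ⟨?_, hfz⟩
    by_contra hlt
    exact absurd (hpos ⟨hz, not_le.1 hlt⟩) (not_lt.2 hfz)
  have hcl : IsClosed S :=
    (hf.mono (Ici_subset_Ioi.2 hε)).preimage_isClosed_of_isClosed isClosed_Ici isClosed_Iic
  have hbdd : BddBelow S := ⟨ε, fun z hz => hz.1⟩
  have hT := hcl.csInf_mem ⟨b, hmem b hb hfb⟩ hbdd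
  have hTpos : 0 < sInf S := hε.trans_le hT.1
  have hbelow : ∀ t ∈ Ioo 0 (sInf S), 0 < f t := by
    intro t ht
    by_contra hn
    exact absurd (csInf_le hbdd (hmem t ht.1 (not_lt.1 hn))) (not_le.2 ht.2)
  refine ⟨sInf S, hTpos, le_antisymm hT.2 ?_, hbelow⟩
  have hct : Tendsto f (𝓝[<] (sInf S)) (𝓝 (f (sInf S))) :=
    ((hf _ hTpos).continuousAt (Ioi_mem_nhds hTpos)).tendsto.mono_left nhdsWithin_le_nhds
  refine ge_of_tendsto hct ?_
  filter_upwards [Ioo_mem_nhdsLT hTpos] with t ht using (hbelow t ht).le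

theorem pos_of_deriv_rlIntegral_nonneg_at_zeros {ρ : ℝ} {f : ℝ → ℝ} (hρ : ρ ∈ Ioo (0 : ℝ) 1)
    (hdiff : ∀ t > 0, DifferentiableAt ℝ f t) (hint : ∀ t > 0, RLIntegrable (ρ - 1) f t)
    (h0 : ∀ᶠ t in 𝓝[>] 0, 0 < f t)
    (hD : ∀ t > 0, f t = 0 → ∃ D ≥ 0, HasDerivAt (rlIntegral (ρ - 1) f) D t) :
    ∀ t > 0, 0 < f t := by
  intro b hb
  by_contra hn
  obtain ⟨T, hT, hfT, hpos⟩ := exists_first_zero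
    (fun t ht => (hdiff t ht).continuousAt.continuousWithinAt) h0 hb (not_lt.1 hn)
  obtain ⟨D, hD0, hD1⟩ := hD T hT hfT
  exact absurd (deriv_rlIntegral_neg_of_first_zero hρ hT hint hpos hfT (hdiff T hT) hD1)
    (not_lt.2 hD0)

/-! ### Bounds for the Mittag-Leffler function on the negative half-line -/

theorem tendsto_rpow_nhdsGT_zero {ρ : ℝ} (hρ : 0 < ρ) :
    Tendsto (fun t : ℝ => t ^ ρ) (𝓝[>] 0) (𝓝[>] 0) := by
  refine tendsto_nhdsWithin_iff.2 ⟨?_, ?_⟩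
  · have := (Real.continuous_rpow_const hρ.le).tendsto (0 : ℝ)
    rw [Real.zero_rpow hρ.ne'] at this
    exact this.mono_left nhdsWithin_le_nhds
  · filter_upwards [self_mem_nhdsWithin] with t ht using Real.rpow_pos_of_pos ht _

theorem mittagLeffler_self_neg_pos {ρ z : ℝ} (hρ : ρ ∈ Ioo (0 : ℝ) 1) (hz : 0 ≤ z) :
    0 < mittagLeffler ρ ρ (-z) := by
  have hE0 : 0 < mittagLeffler ρ ρ 0 := by
    rw [mittagLeffler_zero]; exact one_div_pos.2 (Real.Gamma_pos_of_pos hρ.1)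
  rcases hz.eq_or_lt with rfl | hz
  · simpa using hE0
  have hpos := pos_of_deriv_rlIntegral_nonneg_at_zeros (f := relaxation ρ 1) hρ
    (fun t ht => differentiableAt_relaxation hρ.1 1 ht)
    (fun t ht => rlIntegrable_relaxation hρ 1 ht) ?_ ?_ (z ^ ρ⁻¹) (Real.rpow_pos_of_pos hz _)
  · rw [relaxation, Real.rpow_inv_rpow hz.le hρ.1.ne'] at hpos
    have := pos_of_mul_pos_right hpos (Real.rpow_nonneg (Real.rpow_nonneg hz.le _) _)
    simpa using this
  · have hc : Tendsto (fun z : ℝ => mittagLeffler ρ ρ (-1 * z)) (𝓝[>] 0)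
        (𝓝 (mittagLeffler ρ ρ (-1 * 0))) :=
      (((continuous_mittagLeffler hρ.1 hρ.1).comp (continuous_const.mul continuous_id)).tendsto
        (0 : ℝ)).mono_left nhdsWithin_le_nhds
    rw [mul_zero] at hc
    filter_upwards [(hc.comp (tendsto_rpow_nhdsGT_zero hρ.1)).eventually_const_lt hE0,
      self_mem_nhdsWithin] with t ht ht0
    exact mul_pos (Real.rpow_pos_of_pos ht0 _) ht
  · intro t ht hzero
    exact ⟨_, le_of_eq (by rw [hzero, mul_zero]), hasDerivAt_rlIntegral_relaxation hρ 1 ht⟩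

theorem relaxation_pos {ρ l t : ℝ} (hρ : ρ ∈ Ioo (0 : ℝ) 1) (hl : 0 ≤ l) (ht : 0 < t) :
    0 < relaxation ρ l t := by
  rw [relaxation, neg_mul]
  exact mul_pos (Real.rpow_pos_of_pos ht _)
    (mittagLeffler_self_neg_pos hρ (mul_nonneg hl (Real.rpow_nonneg ht.le _)))

/-- `z ↦ E_{ρ,ρ}(-z)` is decreasing: for `l < m` the difference `d` of the fundamental solutions
with rates `l` and `m` satisfies `∂_t^ρ d = -l d + (m - l) r_m`, so that `∂_t^ρ d > 0` at zeros
of `d`. -/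
theorem mittagLeffler_self_neg_lt {ρ l m : ℝ} (hρ : ρ ∈ Ioo (0 : ℝ) 1) (hl : 0 ≤ l) (hlm : l < m) :
    mittagLeffler ρ ρ (-m) < mittagLeffler ρ ρ (-l) := by
  have hpos := pos_of_deriv_rlIntegral_nonneg_at_zeros
    (f := fun t => relaxation ρ l t - relaxation ρ m t) hρ
    (fun t ht => (differentiableAt_relaxation hρ.1 l ht).sub
      (differentiableAt_relaxation hρ.1 m ht))
    (fun t ht => (rlIntegrable_relaxation hρ l ht).sub (rlIntegrable_relaxation hρ m ht)) ?_ ?_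
    1 one_pos
  · simpa [relaxation] using hpos
  · -- near `0` the sign is that of `(m - l) E_{ρ,ρ}'(0) = (m - l) / Γ(2 ρ)`
    set ψ : ℝ → ℝ := fun z => mittagLeffler ρ ρ (-l * z) - mittagLeffler ρ ρ (-m * z) with hψ
    have hE := hasDerivAt_mittagLeffler hρ.1 hρ.1 0
    have hE0 : (∑' k : ℕ, (k : ℝ) * 0 ^ (k - 1) / Real.Gamma (ρ * k + ρ)) =
        1 / Real.Gamma (ρ + ρ) := by
      rw [tsum_eq_single 1]
      · simp
      · intro k hk
        rcases k with _ | _ | k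
        · simp
        · exact absurd rfl hk
        · simp
    rw [hE0] at hE
    have hlin : ∀ a : ℝ, HasDerivAt (fun z : ℝ => mittagLeffler ρ ρ (-a * z))
        (1 / Real.Gamma (ρ + ρ) * -a) 0 := by
      intro a
      have h1 : HasDerivAt (fun z : ℝ => -a * z) (-a) 0 := by
        simpa using (hasDerivAt_id (0 : ℝ)).const_mul (-a)
      exact HasDerivAt.comp (h₂ := mittagLeffler ρ ρ) 0 (by simpa using hE) h1
    have hψ' : HasDerivAt ψ (1 / Real.Gamma (ρ + ρ) * -l - 1 / Real.Gamma (ρ + ρ) * -m) 0 :=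
      (hlin l).sub (hlin m)
    have hG : 0 < 1 / Real.Gamma (ρ + ρ) :=
      one_div_pos.2 (Real.Gamma_pos_of_pos (add_pos hρ.1 hρ.1))
    have hderiv : 0 < 1 / Real.Gamma (ρ + ρ) * -l - 1 / Real.Gamma (ρ + ρ) * -m := by
      have := mul_pos hG (sub_pos.2 hlm); linarith
    have hev : ∀ᶠ z in 𝓝[>] (0 : ℝ), 0 < ψ z := by
      filter_upwards [hψ'.tendsto_slope_zero_right.eventually_const_lt hderiv,
        self_mem_nhdsWithin] with z hz hz0
      have hψ0 : ψ 0 = 0 := by simp [hψ]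
      rw [zero_add, hψ0, sub_zero, smul_eq_mul] at hz
      exact pos_of_mul_pos_right hz (inv_nonneg.2 (le_of_lt hz0))
    filter_upwards [(tendsto_rpow_nhdsGT_zero hρ.1).eventually hev, self_mem_nhdsWithin]
      with t ht ht0
    simp only [relaxation, ← mul_sub]
    exact mul_pos (Real.rpow_pos_of_pos ht0 _) ht
  · intro t ht hzero
    refine ⟨-l * relaxation ρ l t - -m * relaxation ρ m t, ?_, ?_⟩
    · rw [sub_eq_zero.1 hzero]
      have := mul_pos (sub_pos.2 hlm) (relaxation_pos hρ (hl.trans hlm.le) ht)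
      linarith
    · refine ((hasDerivAt_rlIntegral_relaxation hρ l ht).sub
        (hasDerivAt_rlIntegral_relaxation hρ m ht)).congr_of_eventuallyEq ?_
      filter_upwards [Ioi_mem_nhds ht] with s hs
      exact rlIntegral_sub (rlIntegrable_relaxation hρ l hs) (rlIntegrable_relaxation hρ m hs)

theorem mittagLeffler_self_neg_le {ρ z : ℝ} (hρ : ρ ∈ Ioo (0 : ℝ) 1) (hz : 0 ≤ z) :
    mittagLeffler ρ ρ (-z) ≤ 1 / Real.Gamma ρ := by
  rw [← mittagLeffler_zero ρ ρ]
  rcases hz.eq_or_lt with rfl | hz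
  · simp
  · simpa using (mittagLeffler_self_neg_lt hρ le_rfl hz).le

theorem mittagLeffler_one_neg_nonneg {ρ z : ℝ} (hρ : ρ ∈ Ioo (0 : ℝ) 1) (hz : 0 ≤ z) :
    0 ≤ mittagLeffler ρ 1 (-z) := by
  have h := rlIntegral_relaxation hρ z one_pos
  rw [Real.one_rpow, mul_one] at h
  rw [← h]
  exact rlIntegral_nonneg hρ.2 one_pos fun s hs => (relaxation_pos hρ hz hs.1).le

theorem mittagLeffler_one_neg_le_one {ρ z : ℝ} (hρ : ρ ∈ Ioo (0 : ℝ) 1) (hz : 0 ≤ z) :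
    mittagLeffler ρ 1 (-z) ≤ 1 := by
  have hmono : MonotoneOn (mittagLeffler ρ 1) (Iic 0) := by
    refine monotoneOn_of_hasDerivWithinAt_nonneg (f' := fun z => mittagLeffler ρ ρ z / ρ)
      (convex_Iic 0) (continuous_mittagLeffler hρ.1 one_pos).continuousOn
      (fun x _ => (hasDerivAt_mittagLeffler_one hρ.1 x).hasDerivWithinAt) fun x hx => ?_
    rw [interior_Iic] at hx
    have := mittagLeffler_self_neg_pos hρ (neg_nonneg.2 (le_of_lt hx))
    rw [neg_neg] at this
    exact div_nonneg this.le hρ.1.le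
  have := hmono (show -z ∈ Iic 0 by simpa using hz) (show (0 : ℝ) ∈ Iic 0 by simp) (by linarith)
  simpa [mittagLeffler_zero] using this

/-- The decay bound `E_{ρ,ρ}(-z) = O(1 / z)`: by monotonicity
`(z / 2) E_{ρ,ρ}(-z) ≤ ∫_{z/2}^z E_{ρ,ρ}(-s) ds = ρ (E_{ρ,1}(-z / 2) - E_{ρ,1}(-z)) ≤ ρ`. -/
theorem mul_mittagLeffler_self_neg_le {ρ z : ℝ} (hρ : ρ ∈ Ioo (0 : ℝ) 1) (hz : 0 ≤ z) :
    z * mittagLeffler ρ ρ (-z) ≤ 2 * ρ := by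
  rcases hz.eq_or_lt with rfl | hz
  · simpa using hρ.1.le
  obtain ⟨c, hc, hceq⟩ := exists_hasDerivAt_eq_slope (mittagLeffler ρ 1)
    (fun z => mittagLeffler ρ ρ z / ρ) (show -z < -(z / 2) by linarith)
    (continuous_mittagLeffler hρ.1 one_pos).continuousOn
    fun x _ => hasDerivAt_mittagLeffler_one hρ.1 x
  have h1 : mittagLeffler ρ ρ (-z) ≤ mittagLeffler ρ ρ c := by
    have := mittagLeffler_self_neg_lt hρ (l := -c) (m := z) (by linarith [hc.2]) (by linarith [hc.1])
    rw [neg_neg] at this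
    exact this.le
  have h2 := mittagLeffler_one_neg_nonneg hρ hz.le
  have h3 := mittagLeffler_one_neg_le_one hρ (z := z / 2) (by linarith)
  rw [eq_div_iff (by linarith)] at hceq
  have h4 : mittagLeffler ρ ρ c / ρ * (-(z / 2) - -z) ≤ 1 := by linarith
  have h5 : mittagLeffler ρ ρ c * z = mittagLeffler ρ ρ c / ρ * (-(z / 2) - -z) * (2 * ρ) := by
    have := hρ.1.ne'
    field_simp
    ring
  have h6 := mul_le_mul_of_nonneg_right h4 (by linarith [hρ.1] : 0 ≤ 2 * ρ)
  have h7 := mul_le_mul_of_nonneg_left h1 hz.le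
  linarith

/-! ### Cosine series on `[0, π]` -/

theorem ContinuousOn.intervalIntegrable_mul_zero_pi {h g : ℝ → ℝ}
    (hh : ContinuousOn h (Icc 0 Real.pi)) (hg : Continuous g) :
    IntervalIntegrable (fun x => h x * g x) volume 0 Real.pi :=
  (hh.mul hg.continuousOn).intervalIntegrable_of_Icc Real.pi_pos.le

theorem integral_mul_cos_pow_mul_cos_eq_zero {h : ℝ → ℝ} (hh : ContinuousOn h (Icc 0 Real.pi))
    (h0 : ∀ k : ℕ, ∫ x in (0 : ℝ)..Real.pi, h x * Real.cos (k * x) = 0) (n : ℕ) :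
    ∀ k : ℕ, ∫ x in (0 : ℝ)..Real.pi, h x * (Real.cos x ^ n * Real.cos (k * x)) = 0 := by
  induction n with
  | zero => simpa using h0
  | succ n ih =>
    intro k
    rcases k with _ | k
    · simpa [pow_succ] using ih 1
    · have e : ∀ x : ℝ, h x * (Real.cos x ^ (n + 1) * Real.cos ((k + 1 : ℕ) * x)) =
          1 / 2 * (h x * (Real.cos x ^ n * Real.cos ((k + 2 : ℕ) * x))) +
          1 / 2 * (h x * (Real.cos x ^ n * Real.cos ((k : ℕ) * x))) := by
        intro x
        have e1 : Real.cos ((k + 2 : ℕ) * x) = Real.cos ((k + 1 : ℕ) * x + x) := by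
          congr 1; push_cast; ring
        have e2 : Real.cos ((k : ℕ) * x) = Real.cos ((k + 1 : ℕ) * x - x) := by
          congr 1; push_cast; ring
        rw [e1, e2, Real.cos_add, Real.cos_sub, pow_succ]
        ring
      simp_rw [e]
      rw [intervalIntegral.integral_add, intervalIntegral.integral_const_mul,
        intervalIntegral.integral_const_mul, ih, ih]
      · simp
      · exact (hh.intervalIntegrable_mul_zero_pi (by fun_prop)).const_mul _
      · exact (hh.intervalIntegrable_mul_zero_pi (by fun_prop)).const_mul _

/-- Completeness of the system `cos (k x)`, `k ≥ 0`, on `[0, π]`: by the Weierstrass theorem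
polynomials in `cos x` are dense in `C[0, π]`. -/
theorem eq_zero_of_integral_mul_cos_eq_zero {h : ℝ → ℝ} (hh : ContinuousOn h (Icc 0 Real.pi))
    (h0 : ∀ k : ℕ, ∫ x in (0 : ℝ)..Real.pi, h x * Real.cos (k * x) = 0) :
    ∀ x ∈ Icc 0 Real.pi, h x = 0 := by
  have hpi := Real.pi_pos
  have hpoly : ∀ p : Polynomial ℝ,
      ∫ x in (0 : ℝ)..Real.pi, h x * p.eval (Real.cos x) = 0 := by
    intro p
    simp_rw [Polynomial.eval_eq_sum_range, Finset.mul_sum]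
    rw [intervalIntegral.integral_finsetSum]
    · refine Finset.sum_eq_zero fun n _ => ?_
      have := integral_mul_cos_pow_mul_cos_eq_zero hh h0 n 0
      simp only [Nat.cast_zero, zero_mul, Real.cos_zero, mul_one] at this
      simp_rw [mul_left_comm (h _)]
      rw [intervalIntegral.integral_const_mul, this, mul_zero]
    · intro n _
      exact hh.intervalIntegrable_mul_zero_pi (by fun_prop)
  have hsq : ContinuousOn (fun x => h x * h x) (Icc 0 Real.pi) := hh.mul hh
  have habs : ContinuousOn (fun x => |h x|) (Icc 0 Real.pi) := hh.abs
  have hle : ∀ ε > 0, ∫ x in (0 : ℝ)..Real.pi, h x * h x ≤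
      ε * ∫ x in (0 : ℝ)..Real.pi, |h x| := by
    intro ε hε
    have hc : ContinuousOn (fun y => h (Real.arccos y)) (Icc (-1) 1) :=
      hh.comp Real.continuous_arccos.continuousOn
        fun y _ => ⟨Real.arccos_nonneg y, Real.arccos_le_pi y⟩
    obtain ⟨p, hp⟩ := exists_polynomial_near_of_continuousOn (-1) 1 _ hc ε hε
    have e : ∫ x in (0 : ℝ)..Real.pi, h x * h x =
        ∫ x in (0 : ℝ)..Real.pi, (h x * h x - h x * p.eval (Real.cos x)) := by
      rw [intervalIntegral.integral_sub (hsq.intervalIntegrable_of_Icc hpi.le)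
        (hh.intervalIntegrable_mul_zero_pi (by fun_prop)), hpoly, sub_zero]
    rw [e, ← intervalIntegral.integral_const_mul]
    refine intervalIntegral.integral_mono_on hpi.le
      ((hsq.intervalIntegrable_of_Icc hpi.le).sub
        (hh.intervalIntegrable_mul_zero_pi (by fun_prop)))
      ((habs.intervalIntegrable_of_Icc hpi.le).const_mul _) fun x hx => ?_
    have := hp (Real.cos x) ⟨Real.neg_one_le_cos x, Real.cos_le_one x⟩
    rw [Real.arccos_cos hx.1 hx.2, abs_sub_comm] at this
    calc h x * h x - h x * p.eval (Real.cos x) ≤ |h x * (h x - p.eval (Real.cos x))| := by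
          rw [← mul_sub]; exact le_abs_self _
      _ = |h x - p.eval (Real.cos x)| * |h x| := by rw [abs_mul, mul_comm]
      _ ≤ ε * |h x| := mul_le_mul_of_nonneg_right this.le (abs_nonneg _)
  have hzero : ∫ x in (0 : ℝ)..Real.pi, h x * h x ≤ 0 := by
    have hlim : Tendsto (fun ε : ℝ => ε * ∫ x in (0 : ℝ)..Real.pi, |h x|) (𝓝[>] 0) (𝓝 0) := by
      have : Continuous fun ε : ℝ => ε * ∫ x in (0 : ℝ)..Real.pi, |h x| := by fun_prop
      have := this.tendsto 0
      rw [zero_mul] at this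
      exact this.mono_left nhdsWithin_le_nhds
    refine ge_of_tendsto hlim ?_
    filter_upwards [self_mem_nhdsWithin] with ε hε using hle ε hε
  intro x hx
  by_contra hne
  have := intervalIntegral.integral_pos hpi hsq (fun y _ => mul_self_nonneg _)
    ⟨x, hx, mul_self_pos.2 hne⟩
  linarith

theorem integral_cos_int_mul (m : ℤ) :
    ∫ x in (0 : ℝ)..Real.pi, Real.cos (m * x) = if m = 0 then Real.pi else 0 := by
  split_ifs with hm
  · simp [hm]
  · have hm' : (m : ℝ) ≠ 0 := by exact_mod_cast hm
    rw [intervalIntegral.integral_comp_mul_left (fun x => Real.cos x) hm', integral_cos,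
      Real.sin_int_mul_pi]
    simp

/-- The squared norm of `cos (k x)` in `L²(0, π)`. -/
noncomputable def cosNormSq (k : ℕ) : ℝ := if k = 0 then Real.pi else Real.pi / 2

theorem integral_cos_mul_cos (j k : ℕ) :
    ∫ x in (0 : ℝ)..Real.pi, Real.cos (j * x) * Real.cos (k * x) =
      if j = k then cosNormSq k else 0 := by
  have e : ∀ x : ℝ, Real.cos (j * x) * Real.cos (k * x) =
      1 / 2 * Real.cos (((j - k : ℤ) : ℝ) * x) + 1 / 2 * Real.cos (((j + k : ℤ) : ℝ) * x) := by
    intro x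
    push_cast
    rw [sub_mul, add_mul, Real.cos_sub, Real.cos_add]
    ring
  simp_rw [e]
  rw [intervalIntegral.integral_add (Continuous.intervalIntegrable (by fun_prop) _ _)
    (Continuous.intervalIntegrable (by fun_prop) _ _), intervalIntegral.integral_const_mul,
    intervalIntegral.integral_const_mul, integral_cos_int_mul, integral_cos_int_mul]
  by_cases hjk : j = k
  · subst hjk
    by_cases hj : j = 0
    · simp [hj, cosNormSq]
      ring
    · have : (j + j : ℤ) ≠ 0 := by omega
      simp [hj, cosNormSq, this]
      ring
  · have h1 : (j - k : ℤ) ≠ 0 := by omega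
    have h2 : (j + k : ℤ) ≠ 0 := by omega
    simp [hjk, h1, h2]

theorem integral_sin_mul_sin (j k : ℕ) :
    ∫ x in (0 : ℝ)..Real.pi, Real.sin ((j + 1 : ℕ) * x) * Real.sin ((k + 1 : ℕ) * x) =
      if j = k then Real.pi / 2 else 0 := by
  have e : ∀ x : ℝ, Real.sin ((j + 1 : ℕ) * x) * Real.sin ((k + 1 : ℕ) * x) =
      1 / 2 * Real.cos (((j - k : ℤ) : ℝ) * x) - 1 / 2 * Real.cos (((j + k + 2 : ℤ) : ℝ) * x) := by
    intro x
    rw [show (((j - k : ℤ) : ℝ) * x) = (j + 1 : ℕ) * x - (k + 1 : ℕ) * x by push_cast; ring,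
      show (((j + k + 2 : ℤ) : ℝ) * x) = (j + 1 : ℕ) * x + (k + 1 : ℕ) * x by push_cast; ring,
      Real.cos_sub, Real.cos_add]
    ring
  simp_rw [e]
  rw [intervalIntegral.integral_sub (Continuous.intervalIntegrable (by fun_prop) _ _)
    (Continuous.intervalIntegrable (by fun_prop) _ _), intervalIntegral.integral_const_mul,
    intervalIntegral.integral_const_mul, integral_cos_int_mul, integral_cos_int_mul]
  have h2 : (j + k + 2 : ℤ) ≠ 0 := by omega
  by_cases hjk : j = k
  · subst hjk
    simp [h2]
    ring
  · have h1 : (j - k : ℤ) ≠ 0 := by omega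
    simp [hjk, h1, h2]

/-- Bessel's inequality for the sine system. -/
theorem summable_sq_integral_mul_sin {ψ : ℝ → ℝ} (hψ : ContinuousOn ψ (Icc 0 Real.pi)) :
    Summable fun k : ℕ => (∫ x in (0 : ℝ)..Real.pi, ψ x * Real.sin ((k + 1 : ℕ) * x)) ^ 2 := by
  have hpi := Real.pi_pos
  set b : ℕ → ℝ := fun k => ∫ x in (0 : ℝ)..Real.pi, ψ x * Real.sin ((k + 1 : ℕ) * x) with hb
  have hψi : IntervalIntegrable (fun x => ψ x * ψ x) volume 0 Real.pi :=
    (hψ.mul hψ).intervalIntegrable_of_Icc hpi.le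
  refine summable_of_sum_range_le (c := Real.pi / 2 * ∫ x in (0 : ℝ)..Real.pi, ψ x * ψ x)
    (fun k => sq_nonneg _) fun n => ?_
  set S : ℝ → ℝ := fun x => ∑ k ∈ Finset.range n, b k * Real.sin ((k + 1 : ℕ) * x) with hS
  have hSc : Continuous S := by fun_prop
  have hψS : ∫ x in (0 : ℝ)..Real.pi, ψ x * S x = ∑ k ∈ Finset.range n, b k ^ 2 := by
    simp_rw [hS, Finset.mul_sum]
    rw [intervalIntegral.integral_finsetSum
      fun k _ => hψ.intervalIntegrable_mul_zero_pi (by fun_prop)]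
    refine Finset.sum_congr rfl fun k _ => ?_
    simp_rw [mul_left_comm (ψ _)]
    rw [intervalIntegral.integral_const_mul, sq]
  have hSS : ∫ x in (0 : ℝ)..Real.pi, S x * S x =
      Real.pi / 2 * ∑ k ∈ Finset.range n, b k ^ 2 := by
    have h1 : ∀ x, S x * S x = ∑ k ∈ Finset.range n, b k * ∑ j ∈ Finset.range n,
        b j * (Real.sin ((j + 1 : ℕ) * x) * Real.sin ((k + 1 : ℕ) * x)) := by
      intro x
      simp only [hS]
      rw [Finset.sum_mul_sum, Finset.sum_comm]
      refine Finset.sum_congr rfl fun k _ => ?_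
      rw [Finset.mul_sum]
      exact Finset.sum_congr rfl fun j _ => by ring
    simp_rw [h1]
    rw [intervalIntegral.integral_finsetSum
      fun k _ => Continuous.intervalIntegrable (by fun_prop) _ _, Finset.mul_sum]
    refine Finset.sum_congr rfl fun k hk => ?_
    rw [intervalIntegral.integral_const_mul, intervalIntegral.integral_finsetSum
      fun k _ => Continuous.intervalIntegrable (by fun_prop) _ _]
    simp_rw [intervalIntegral.integral_const_mul, integral_sin_mul_sin]
    simp only [mul_ite, mul_zero, Finset.sum_ite_eq', hk, if_true]
    ring
  have hSSi : IntervalIntegrable (fun x => S x * S x) volume 0 Real.pi :=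
    Continuous.intervalIntegrable (by fun_prop) _ _
  have hnonneg : 0 ≤ ∫ x in (0 : ℝ)..Real.pi, (ψ x - 2 / Real.pi * S x) ^ 2 :=
    intervalIntegral.integral_nonneg hpi.le fun x _ => sq_nonneg _
  have e : ∫ x in (0 : ℝ)..Real.pi, (ψ x - 2 / Real.pi * S x) ^ 2 =
      (∫ x in (0 : ℝ)..Real.pi, ψ x * ψ x) - 4 / Real.pi * (∑ k ∈ Finset.range n, b k ^ 2) +
        (2 / Real.pi) ^ 2 * (Real.pi / 2 * ∑ k ∈ Finset.range n, b k ^ 2) := by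
    rw [← hSS, ← hψS, ← intervalIntegral.integral_const_mul, ← intervalIntegral.integral_const_mul,
      ← intervalIntegral.integral_sub hψi
        ((hψ.intervalIntegrable_mul_zero_pi hSc).const_mul _), ← intervalIntegral.integral_add
        (hψi.sub ((hψ.intervalIntegrable_mul_zero_pi hSc).const_mul _))
        (hSSi.const_mul _)]
    exact intervalIntegral.integral_congr fun x _ => by ring
  rw [e] at hnonneg
  have e2 : (2 / Real.pi) ^ 2 * (Real.pi / 2 * ∑ k ∈ Finset.range n, b k ^ 2) =
      2 / Real.pi * ∑ k ∈ Finset.range n, b k ^ 2 := by field_simp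
  have e3 : ∑ k ∈ Finset.range n, b k ^ 2 =
      Real.pi / 2 * (4 / Real.pi * (∑ k ∈ Finset.range n, b k ^ 2) -
        2 / Real.pi * ∑ k ∈ Finset.range n, b k ^ 2) := by field_simp; ring
  rw [e3]
  refine mul_le_mul_of_nonneg_left ?_ (by positivity)
  linarith

theorem integral_mul_cos_eq_cosCoeff (φ : ℝ → ℝ) (k : ℕ) :
    ∫ x in (0 : ℝ)..Real.pi, φ x * Real.cos (k * x) = cosCoeff φ k * cosNormSq k := by
  have := Real.pi_ne_zero
  rw [cosCoeff, cosNormSq]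
  split_ifs <;> field_simp

theorem integral_mul_cos_eq_integral_derivWithin_mul_sin {φ : ℝ → ℝ}
    (hφ : ContDiffOn ℝ 1 φ (Icc 0 Real.pi)) (k : ℕ) :
    ∫ x in (0 : ℝ)..Real.pi, φ x * Real.cos ((k + 1 : ℕ) * x) =
      -(1 / ((k + 1 : ℕ) : ℝ)) * ∫ x in (0 : ℝ)..Real.pi,
        derivWithin φ (Icc 0 Real.pi) x * Real.sin ((k + 1 : ℕ) * x) := by
  have hpi := Real.pi_pos
  have hk : ((k + 1 : ℕ) : ℝ) ≠ 0 := by positivity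
  have hd : ContinuousOn (derivWithin φ (Icc 0 Real.pi)) (Icc 0 Real.pi) :=
    hφ.continuousOn_derivWithin (uniqueDiffOn_Icc hpi) le_rfl
  have h := intervalIntegral.integral_mul_deriv_eq_deriv_mul_of_hasDerivAt
    (a := 0) (b := Real.pi) (u := φ) (v := fun x => Real.sin ((k + 1 : ℕ) * x) / (k + 1 : ℕ))
    (u' := derivWithin φ (Icc 0 Real.pi)) (v' := fun x => Real.cos ((k + 1 : ℕ) * x))
    (by rw [uIcc_of_le hpi.le]; exact hφ.continuousOn) (by fun_prop) ?_ ?_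
    (hd.intervalIntegrable_of_Icc hpi.le) (Continuous.intervalIntegrable (by fun_prop) _ _)
  · rw [h, Real.sin_nat_mul_pi, mul_zero, Real.sin_zero]
    simp_rw [← mul_div_assoc]
    rw [intervalIntegral.integral_div]
    ring
  · intro x hx
    rw [min_eq_left hpi.le, max_eq_right hpi.le] at hx
    exact ((hφ.differentiableOn one_ne_zero) x (Ioo_subset_Icc_self hx)).hasDerivWithinAt.hasDerivAt
      (Icc_mem_nhds hx.1 hx.2)
  · intro x _
    have := ((hasDerivAt_id x).const_mul ((k + 1 : ℕ) : ℝ)).sin.div_const ((k + 1 : ℕ) : ℝ)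
    refine this.congr_deriv ?_
    simp only [id]
    field_simp

/-- The Fourier cosine series of a `C¹` function converges absolutely: after one integration by
parts the coefficients are `1 / k` times a square summable sequence. -/
theorem summable_abs_cosCoeff {φ : ℝ → ℝ} (hφ : ContDiffOn ℝ 1 φ (Icc 0 Real.pi)) :
    Summable fun k => |cosCoeff φ k| := by
  have hpi := Real.pi_pos
  have hd : ContinuousOn (derivWithin φ (Icc 0 Real.pi)) (Icc 0 Real.pi) :=
    hφ.continuousOn_derivWithin (uniqueDiffOn_Icc hpi) le_rfl
  rw [← summable_nat_add_iff 1]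
  have h1 := summable_sq_integral_mul_sin hd
  have h2 : Summable fun k : ℕ => 1 / (((k + 1 : ℕ) : ℝ)) ^ 2 :=
    (summable_nat_add_iff 1).2 (Real.summable_one_div_nat_pow.2 one_lt_two)
  refine ((h1.add h2).mul_left (1 / Real.pi)).of_nonneg_of_le (fun k => abs_nonneg _) fun k => ?_
  set b := ∫ x in (0 : ℝ)..Real.pi,
    derivWithin φ (Icc 0 Real.pi) x * Real.sin ((k + 1 : ℕ) * x) with hb
  rw [cosCoeff, integral_mul_cos_eq_integral_derivWithin_mul_sin hφ, if_neg (Nat.succ_ne_zero k),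
    ← hb, abs_mul, abs_mul, abs_neg, abs_of_pos (by positivity : 0 < 2 / Real.pi),
    abs_of_pos (by positivity : 0 < 1 / ((k + 1 : ℕ) : ℝ))]
  have h3 : 2 * (1 / ((k + 1 : ℕ) : ℝ) * |b|) ≤ b ^ 2 + 1 / ((k + 1 : ℕ) : ℝ) ^ 2 := by
    have := two_mul_le_add_sq (1 / ((k + 1 : ℕ) : ℝ)) |b|
    rw [sq_abs, div_pow, one_pow] at this
    linarith
  calc 2 / Real.pi * (1 / ((k + 1 : ℕ) : ℝ) * |b|) =
      1 / Real.pi * (2 * (1 / ((k + 1 : ℕ) : ℝ) * |b|)) := by ring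
    _ ≤ _ := mul_le_mul_of_nonneg_left h3 (by positivity)

theorem norm_mul_cos_le (c y : ℝ) : ‖c * Real.cos y‖ ≤ |c| := by
  rw [norm_mul]
  exact mul_le_of_le_one_right (norm_nonneg _) (Real.abs_cos_le_one _)

theorem norm_mul_sin_le (c y : ℝ) : ‖c * Real.sin y‖ ≤ |c| := by
  rw [norm_mul]
  exact mul_le_of_le_one_right (norm_nonneg _) (Real.abs_sin_le_one _)

theorem continuous_tsum_mul_cos {c : ℕ → ℝ} (hc : Summable fun k => |c k|) :
    Continuous fun x : ℝ => ∑' k : ℕ, c k * Real.cos (k * x) :=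
  continuous_tsum (fun k => by fun_prop) hc fun _ _ => norm_mul_cos_le _ _

theorem integral_tsum_mul_cos_mul_cos {c : ℕ → ℝ} (hc : Summable fun k => |c k|) (j : ℕ) :
    ∫ x in (0 : ℝ)..Real.pi, (∑' k : ℕ, c k * Real.cos (k * x)) * Real.cos (j * x) =
      c j * cosNormSq j := by
  have h := intervalIntegral.hasSum_integral_of_dominated_convergence (μ := volume)
    (a := 0) (b := Real.pi) (F := fun (k : ℕ) (x : ℝ) => c k * Real.cos (k * x) * Real.cos (j * x))
    (f := fun x => (∑' k : ℕ, c k * Real.cos (k * x)) * Real.cos (j * x))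
    (fun k _ => |c k|) (fun k => Continuous.aestronglyMeasurable (by fun_prop)) ?_ ?_ ?_ ?_
  · have e : ∀ k : ℕ, ∫ x in (0 : ℝ)..Real.pi, c k * Real.cos (k * x) * Real.cos (j * x) =
        if k = j then c j * cosNormSq j else 0 := by
      intro k
      simp_rw [mul_assoc]
      rw [intervalIntegral.integral_const_mul, integral_cos_mul_cos]
      split_ifs with hkj <;> simp [hkj]
    simp_rw [e] at h
    exact h.unique (hasSum_ite_eq j _)
  · exact fun k => Eventually.of_forall fun x _ =>
      (norm_mul_cos_le _ _).trans (by rw [← Real.norm_eq_abs]; exact norm_mul_cos_le _ _)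
  · exact Eventually.of_forall fun x _ => hc
  · simp
  · refine Eventually.of_forall fun x _ => HasSum.mul_right _ (Summable.hasSum ?_)
    exact hc.of_norm_bounded fun k => norm_mul_cos_le _ _

theorem tsum_cosCoeff_mul_cos {φ : ℝ → ℝ} (hφ : ContDiffOn ℝ 1 φ (Icc 0 Real.pi)) :
    ∀ x ∈ Icc 0 Real.pi, ∑' k : ℕ, cosCoeff φ k * Real.cos (k * x) = φ x := by
  have hc := summable_abs_cosCoeff hφ
  have hS := continuous_tsum_mul_cos hc
  have := eq_zero_of_integral_mul_cos_eq_zero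
    (h := fun x => (∑' k : ℕ, cosCoeff φ k * Real.cos (k * x)) - φ x)
    (hS.continuousOn.sub hφ.continuousOn) fun j => by
      simp_rw [sub_mul]
      rw [intervalIntegral.integral_sub (Continuous.intervalIntegrable (by fun_prop) _ _)
        (hφ.continuousOn.intervalIntegrable_mul_zero_pi (by fun_prop)),
        integral_tsum_mul_cos_mul_cos hc, integral_mul_cos_eq_cosCoeff, sub_self]
  exact fun x hx => sub_eq_zero.1 (this x hx)

/-! ### The Fourier series solution -/

theorem relaxation_le {ρ l t : ℝ} (hρ : ρ ∈ Ioo (0 : ℝ) 1) (hl : 0 ≤ l) (ht : 0 < t) :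
    relaxation ρ l t ≤ 1 / Real.Gamma ρ * t ^ (ρ - 1) := by
  rw [relaxation, neg_mul, mul_comm]
  exact mul_le_mul_of_nonneg_right
    (mittagLeffler_self_neg_le hρ (mul_nonneg hl (Real.rpow_nonneg ht.le _)))
    (Real.rpow_nonneg ht.le _)

theorem relaxation_eq_div {ρ t : ℝ} (l : ℝ) (ht : 0 < t) :
    relaxation ρ l t = t ^ ρ * mittagLeffler ρ ρ (-(l * t ^ ρ)) / t := by
  rw [relaxation, neg_mul, Real.rpow_sub_one ht.ne']
  ring

theorem mul_relaxation_le {ρ l t : ℝ} (hρ : ρ ∈ Ioo (0 : ℝ) 1) (hl : 0 ≤ l) (ht : 0 < t) :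
    l * relaxation ρ l t ≤ 2 * ρ / t := by
  rw [relaxation_eq_div l ht, ← mul_div_assoc, ← mul_assoc]
  exact div_le_div_of_nonneg_right
    (mul_mittagLeffler_self_neg_le hρ (mul_nonneg hl (Real.rpow_nonneg ht.le _))) ht.le

theorem abs_natCast_mul_relaxation_le {ρ t : ℝ} (hρ : ρ ∈ Ioo (0 : ℝ) 1) (ht : 0 < t) (k : ℕ) :
    |-(k : ℝ) * relaxation ρ ((k : ℝ) ^ 2) t| ≤ 2 * ρ / t := by
  have hr := relaxation_pos hρ (sq_nonneg (k : ℝ)) ht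
  rw [neg_mul, abs_neg, abs_of_nonneg (by positivity)]
  refine le_trans ?_ (mul_relaxation_le hρ (sq_nonneg (k : ℝ)) ht)
  refine mul_le_mul_of_nonneg_right ?_ hr.le
  exact_mod_cast Nat.le_self_pow two_ne_zero k

theorem abs_sq_mul_relaxation_le {ρ t : ℝ} (hρ : ρ ∈ Ioo (0 : ℝ) 1) (ht : 0 < t) (k : ℕ) :
    |-(k : ℝ) ^ 2 * relaxation ρ ((k : ℝ) ^ 2) t| ≤ 2 * ρ / t := by
  have hr := relaxation_pos hρ (sq_nonneg (k : ℝ)) ht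
  rw [neg_mul, abs_neg, abs_of_nonneg (by positivity)]
  exact mul_relaxation_le hρ (sq_nonneg (k : ℝ)) ht

/-- The series `∑ c_k t ^ (ρ - 1) E_{ρ,ρ}(-k² t ^ ρ) cos (k x)`. -/
noncomputable def cosSeries (ρ : ℝ) (c : ℕ → ℝ) (x t : ℝ) : ℝ :=
  ∑' k : ℕ, c k * relaxation ρ ((k : ℝ) ^ 2) t * Real.cos (k * x)

/-- The termwise `x`-derivative of `cosSeries`. -/
noncomputable def cosSeriesDeriv (ρ : ℝ) (c : ℕ → ℝ) (x t : ℝ) : ℝ :=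
  ∑' k : ℕ, c k * (-(k : ℝ) * relaxation ρ ((k : ℝ) ^ 2) t) * Real.sin (k * x)

/-- The termwise second `x`-derivative of `cosSeries`; it is also its termwise fractional
derivative of order `ρ` in `t`. -/
noncomputable def cosSeriesDeriv₂ (ρ : ℝ) (c : ℕ → ℝ) (x t : ℝ) : ℝ :=
  ∑' k : ℕ, c k * (-(k : ℝ) ^ 2 * relaxation ρ ((k : ℝ) ^ 2) t) * Real.cos (k * x)

/-- The termwise fractional integral of order `1 - ρ` in `t` of `cosSeries`. -/
noncomputable def cosSeriesIntegral (ρ : ℝ) (c : ℕ → ℝ) (x t : ℝ) : ℝ :=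
  ∑' k : ℕ, c k * mittagLeffler ρ 1 (-(k : ℝ) ^ 2 * t ^ ρ) * Real.cos (k * x)

section Series

variable {ρ : ℝ} {c : ℕ → ℝ}

theorem summable_mul_of_abs_le (hc : Summable fun k => |c k|) {m : ℕ → ℝ} {B : ℝ}
    (hm : ∀ k, |m k| ≤ B) : Summable fun k => |c k * m k| := by
  refine (hc.mul_right B).of_nonneg_of_le (fun k => abs_nonneg _) fun k => ?_
  rw [abs_mul]
  exact mul_le_mul_of_nonneg_left (hm k) (abs_nonneg _)

theorem summable_mul_relaxation (hρ : ρ ∈ Ioo (0 : ℝ) 1) (hc : Summable fun k => |c k|) {t : ℝ}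
    (ht : 0 < t) : Summable fun k : ℕ => |c k * relaxation ρ ((k : ℝ) ^ 2) t| :=
  summable_mul_of_abs_le hc fun k => by
    rw [abs_of_pos (relaxation_pos hρ (sq_nonneg _) ht)]
    exact relaxation_le hρ (sq_nonneg _) ht

theorem hasSum_cosSeries (hρ : ρ ∈ Ioo (0 : ℝ) 1) (hc : Summable fun k => |c k|) (x : ℝ) {t : ℝ}
    (ht : 0 < t) : HasSum (fun k : ℕ => c k * relaxation ρ ((k : ℝ) ^ 2) t * Real.cos (k * x))
      (cosSeries ρ c x t) :=
  ((summable_mul_relaxation hρ hc ht).of_norm_bounded fun _ => norm_mul_cos_le _ _).hasSum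

theorem continuousOn_tsum_mul_mul_cos (hc : Summable fun k => |c k|) {m : ℕ → ℝ → ℝ} {s : Set ℝ}
    {B : ℝ} (hm : ∀ k, ContinuousOn (m k) s) (hB : ∀ k, ∀ t ∈ s, |m k t| ≤ B) :
    ContinuousOn (fun p : ℝ × ℝ => ∑' k : ℕ, c k * m k p.2 * Real.cos (k * p.1))
      (Icc 0 Real.pi ×ˢ s) := by
  refine continuousOn_tsum (u := fun k => |c k| * B) (fun k => ?_) (hc.mul_right B) ?_
  · refine ContinuousOn.mul (continuousOn_const.mul ?_) (by fun_prop)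
    exact (hm k).comp continuous_snd.continuousOn fun p hp => hp.2
  · intro k p hp
    refine (norm_mul_cos_le _ _).trans ?_
    rw [abs_mul]
    exact mul_le_mul_of_nonneg_left (hB k _ hp.2) (abs_nonneg _)

theorem continuous_mittagLeffler_comp (hρ : ρ ∈ Ioo (0 : ℝ) 1) {μ : ℝ} (hμ : 0 < μ) (l : ℝ) :
    Continuous fun t : ℝ => mittagLeffler ρ μ (-l * t ^ ρ) :=
  (continuous_mittagLeffler hρ.1 hμ).comp
    (continuous_const.mul (Real.continuous_rpow_const hρ.1.le))

theorem continuousOn_cosSeries (hρ : ρ ∈ Ioo (0 : ℝ) 1) (hc : Summable fun k => |c k|) :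
    ContinuousOn (fun p : ℝ × ℝ => cosSeries ρ c p.1 p.2) (Icc 0 Real.pi ×ˢ Ioi 0) := by
  have h := continuousOn_tsum_mul_mul_cos (s := Ioi 0) (B := 1 / Real.Gamma ρ) hc
    (m := fun k t => mittagLeffler ρ ρ (-(k : ℝ) ^ 2 * t ^ ρ))
    (fun k => (continuous_mittagLeffler_comp hρ hρ.1 _).continuousOn) fun k t ht => by
      have hz : 0 ≤ (k : ℝ) ^ 2 * t ^ ρ :=
        mul_nonneg (sq_nonneg _) (Real.rpow_nonneg (le_of_lt ht) _)
      rw [neg_mul, abs_of_pos (mittagLeffler_self_neg_pos hρ hz)]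
      exact mittagLeffler_self_neg_le hρ hz
  have hpow : ContinuousOn (fun p : ℝ × ℝ => p.2 ^ (ρ - 1)) (Icc 0 Real.pi ×ˢ Ioi 0) :=
    continuousOn_snd.rpow_const fun p hp => Or.inl (ne_of_gt hp.2)
  refine (hpow.mul h).congr fun p _ => ?_
  simp only [cosSeries, relaxation, Pi.mul_apply]
  rw [← tsum_mul_left]
  exact tsum_congr fun k => by ring

theorem continuousOn_cosSeriesDeriv₂ (hρ : ρ ∈ Ioo (0 : ℝ) 1) (hc : Summable fun k => |c k|) :
    ContinuousOn (fun p : ℝ × ℝ => cosSeriesDeriv₂ ρ c p.1 p.2) (Icc 0 Real.pi ×ˢ Ioi 0) := by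
  have h := continuousOn_tsum_mul_mul_cos (s := Ioi 0) (B := 2 * ρ) hc
    (m := fun k t => t * (-(k : ℝ) ^ 2 * relaxation ρ ((k : ℝ) ^ 2) t))
    (fun k => continuousOn_id.mul (continuousOn_const.mul (continuousOn_relaxation hρ.1 _)))
    fun k t ht => by
      have ht : 0 < t := ht
      have := mul_le_mul_of_nonneg_left (abs_sq_mul_relaxation_le hρ ht k) ht.le
      rw [abs_mul, abs_of_pos ht]
      rwa [mul_div_cancel₀ _ ht.ne'] at this
  have hinv : ContinuousOn (fun p : ℝ × ℝ => p.2⁻¹) (Icc 0 Real.pi ×ˢ Ioi 0) :=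
    continuousOn_snd.inv₀ fun p hp => ne_of_gt hp.2
  refine (hinv.mul h).congr fun p hp => ?_
  simp only [cosSeriesDeriv₂, Pi.mul_apply]
  rw [← tsum_mul_left]
  refine tsum_congr fun k => ?_
  have : p.2 ≠ 0 := ne_of_gt hp.2
  field_simp

theorem continuousOn_cosSeriesIntegral (hρ : ρ ∈ Ioo (0 : ℝ) 1) (hc : Summable fun k => |c k|) :
    ContinuousOn (fun p : ℝ × ℝ => cosSeriesIntegral ρ c p.1 p.2) (Icc 0 Real.pi ×ˢ Ici 0) :=
  continuousOn_tsum_mul_mul_cos (B := 1) hc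
    (m := fun k t => mittagLeffler ρ 1 (-(k : ℝ) ^ 2 * t ^ ρ))
    (fun k => (continuous_mittagLeffler_comp hρ one_pos _).continuousOn) fun k t ht => by
      have hz : 0 ≤ (k : ℝ) ^ 2 * t ^ ρ := mul_nonneg (sq_nonneg _) (Real.rpow_nonneg ht _)
      rw [neg_mul, abs_of_nonneg (mittagLeffler_one_neg_nonneg hρ hz)]
      exact mittagLeffler_one_neg_le_one hρ hz

theorem hasDerivAt_cosSeries (hρ : ρ ∈ Ioo (0 : ℝ) 1) (hc : Summable fun k => |c k|) {t : ℝ}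
    (ht : 0 < t) (x : ℝ) :
    HasDerivAt (fun y => cosSeries ρ c y t) (cosSeriesDeriv ρ c x t) x := by
  refine hasDerivAt_tsum (summable_mul_of_abs_le hc (abs_natCast_mul_relaxation_le hρ ht))
    (g := fun (k : ℕ) (y : ℝ) => c k * relaxation ρ ((k : ℝ) ^ 2) t * Real.cos (k * y))
    (g' := fun (k : ℕ) (y : ℝ) =>
      c k * (-(k : ℝ) * relaxation ρ ((k : ℝ) ^ 2) t) * Real.sin (k * y))
    (fun k y => ?_) (fun k y => norm_mul_sin_le _ _) (hasSum_cosSeries hρ hc 0 ht).summable x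
  refine ((((hasDerivAt_id y).const_mul (k : ℝ)).cos).const_mul _).congr_deriv ?_
  simp only [id]
  ring

theorem hasDerivAt_cosSeriesDeriv (hρ : ρ ∈ Ioo (0 : ℝ) 1) (hc : Summable fun k => |c k|) {t : ℝ}
    (ht : 0 < t) (x : ℝ) :
    HasDerivAt (fun y => cosSeriesDeriv ρ c y t) (cosSeriesDeriv₂ ρ c x t) x := by
  refine hasDerivAt_tsum (summable_mul_of_abs_le hc (abs_sq_mul_relaxation_le hρ ht))
    (g := fun (k : ℕ) (y : ℝ) =>
      c k * (-(k : ℝ) * relaxation ρ ((k : ℝ) ^ 2) t) * Real.sin (k * y))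
    (g' := fun (k : ℕ) (y : ℝ) =>
      c k * (-(k : ℝ) ^ 2 * relaxation ρ ((k : ℝ) ^ 2) t) * Real.cos (k * y))
    (fun k y => ?_) (fun k y => norm_mul_cos_le _ _) ((summable_mul_of_abs_le hc
      (abs_natCast_mul_relaxation_le hρ ht)).of_norm_bounded fun k => norm_mul_sin_le _ (k * 0)) x
  refine ((((hasDerivAt_id y).const_mul (k : ℝ)).sin).const_mul _).congr_deriv ?_
  simp only [id]
  ring

theorem spaceDeriv_cosSeries (hρ : ρ ∈ Ioo (0 : ℝ) 1) (hc : Summable fun k => |c k|) {x t : ℝ}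
    (hx : x ∈ Icc 0 Real.pi) (ht : 0 < t) :
    spaceDeriv (cosSeries ρ c) x t = cosSeriesDeriv ρ c x t :=
  (hasDerivAt_cosSeries hρ hc ht x).hasDerivWithinAt.derivWithin
    (uniqueDiffOn_Icc Real.pi_pos x hx)

theorem spaceDeriv₂_cosSeries (hρ : ρ ∈ Ioo (0 : ℝ) 1) (hc : Summable fun k => |c k|) {x t : ℝ}
    (hx : x ∈ Icc 0 Real.pi) (ht : 0 < t) :
    spaceDeriv₂ (cosSeries ρ c) x t = cosSeriesDeriv₂ ρ c x t := by
  rw [spaceDeriv₂, spaceDeriv, derivWithin_congr (f := fun y => cosSeriesDeriv ρ c y t)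
    (fun y hy => spaceDeriv_cosSeries hρ hc hy ht) (spaceDeriv_cosSeries hρ hc hx ht)]
  exact (hasDerivAt_cosSeriesDeriv hρ hc ht x).hasDerivWithinAt.derivWithin
    (uniqueDiffOn_Icc Real.pi_pos x hx)

theorem rlIntegrable_cosSeries (hρ : ρ ∈ Ioo (0 : ℝ) 1) (hc : Summable fun k => |c k|) {x t : ℝ}
    (hx : x ∈ Icc 0 Real.pi) (ht : 0 < t) : RLIntegrable (ρ - 1) (cosSeries ρ c x) t := by
  have hcont : ContinuousOn (cosSeries ρ c x) (Ioi 0) :=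
    (continuousOn_cosSeries hρ hc).comp (f := fun s => (x, s)) (by fun_prop)
      fun s hs => ⟨hx, hs⟩
  refine rlIntegrable_of_continuousOn_of_le (C := (∑' k, |c k|) * (1 / Real.Gamma ρ)) hρ ht hcont
    fun ξ hξ => ?_
  rw [mul_assoc]
  refine tsum_of_norm_bounded (hc.hasSum.mul_right _) fun k => (norm_mul_cos_le _ _).trans ?_
  rw [abs_mul, abs_of_pos (relaxation_pos hρ (sq_nonneg _) hξ.1)]
  exact mul_le_mul_of_nonneg_left (relaxation_le hρ (sq_nonneg _) hξ.1) (abs_nonneg _)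

theorem rlIntegral_cosSeries (hρ : ρ ∈ Ioo (0 : ℝ) 1) (hc : Summable fun k => |c k|) (x : ℝ)
    {t : ℝ} (ht : 0 < t) :
    rlIntegral (ρ - 1) (cosSeries ρ c x) t = cosSeriesIntegral ρ c x t := by
  have hG : 0 < Real.Gamma (-(ρ - 1)) := Real.Gamma_pos_of_pos (by linarith [hρ.2])
  let F : ℕ → ℝ → ℝ := fun k ξ => c k * Real.cos (k * x) *
    (relaxation ρ ((k : ℝ) ^ 2) ξ / (t - ξ) ^ (ρ - 1 + 1))
  have hval : ∀ k : ℕ, ∫ ξ in Ioc 0 t,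
      relaxation ρ ((k : ℝ) ^ 2) ξ / (t - ξ) ^ (ρ - 1 + 1) =
      Real.Gamma (-(ρ - 1)) * mittagLeffler ρ 1 (-(k : ℝ) ^ 2 * t ^ ρ) := fun k => by
    rw [← rlIntegral_relaxation hρ _ ht, rlIntegral, ← intervalIntegral.integral_of_le ht.le]
    field_simp
  have hFint : ∀ k, IntegrableOn (F k) (Ioc 0 t) := fun k =>
    ((intervalIntegrable_iff_integrableOn_Ioc_of_le ht.le).1
      (rlIntegrable_relaxation hρ _ ht)).const_mul _
  have hFnorm : ∀ k : ℕ, ∫ ξ in Ioc 0 t, ‖F k ξ‖ = |c k * Real.cos (k * x)| *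
      (Real.Gamma (-(ρ - 1)) * mittagLeffler ρ 1 (-(k : ℝ) ^ 2 * t ^ ρ)) := fun k => by
    rw [← hval, ← integral_const_mul]
    refine setIntegral_congr_fun measurableSet_Ioc fun ξ hξ => ?_
    have e1 := relaxation_pos hρ (sq_nonneg (k : ℝ)) hξ.1
    have e2 : 0 ≤ (t - ξ) ^ (ρ - 1 + 1) := Real.rpow_nonneg (by linarith [hξ.2]) _
    simp only [F, norm_mul, norm_div, Real.norm_eq_abs, abs_mul, abs_of_pos e1, abs_of_nonneg e2]
  have hsum : Summable fun k => ∫ ξ in Ioc 0 t, ‖F k ξ‖ := by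
    simp_rw [hFnorm]
    refine (hc.mul_right (Real.Gamma (-(ρ - 1)))).of_nonneg_of_le (fun k => ?_) fun k => ?_
    all_goals have hz : 0 ≤ (k : ℝ) ^ 2 * t ^ ρ := mul_nonneg (sq_nonneg _) (Real.rpow_nonneg ht.le _)
    all_goals rw [neg_mul]
    · have := mittagLeffler_one_neg_nonneg hρ hz
      positivity
    · refine mul_le_mul (norm_mul_cos_le _ _) ?_
        (mul_nonneg hG.le (mittagLeffler_one_neg_nonneg hρ hz)) (abs_nonneg _)
      exact mul_le_of_le_one_right hG.le (mittagLeffler_one_neg_le_one hρ hz)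
  have h := integral_tsum_of_summable_integral_norm hFint hsum
  have htsum : ∀ ξ, ∑' k, F k ξ = cosSeries ρ c x ξ / (t - ξ) ^ (ρ - 1 + 1) := by
    intro ξ
    rw [cosSeries, ← tsum_div_const]
    exact tsum_congr fun k => by simp only [F]; ring
  simp_rw [htsum] at h
  rw [rlIntegral, intervalIntegral.integral_of_le ht.le, ← h, cosSeriesIntegral, ← tsum_mul_left]
  refine tsum_congr fun k => ?_
  simp only [F]
  rw [integral_const_mul, hval]
  field_simp

theorem hasDerivAt_cosSeriesIntegral (hρ : ρ ∈ Ioo (0 : ℝ) 1) (hc : Summable fun k => |c k|)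
    (x : ℝ) {t : ℝ} (ht : 0 < t) :
    HasDerivAt (cosSeriesIntegral ρ c x) (cosSeriesDeriv₂ ρ c x t) t := by
  have ht2 : 0 < t / 2 := by positivity
  refine hasDerivAt_tsum_of_isPreconnected (u := fun k => |c k| * (2 * ρ / (t / 2)))
    (hc.mul_right _) isOpen_Ioi (convex_Ioi (t / 2)).isPreconnected
    (g := fun (k : ℕ) (s : ℝ) =>
      c k * mittagLeffler ρ 1 (-(k : ℝ) ^ 2 * s ^ ρ) * Real.cos (k * x))
    (g' := fun (k : ℕ) (s : ℝ) =>
      c k * (-(k : ℝ) ^ 2 * relaxation ρ ((k : ℝ) ^ 2) s) * Real.cos (k * x))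
    (y₀ := t) (fun k s hs => ?_) (fun k s hs => ?_) (half_lt_self ht) ?_ (half_lt_self ht)
  · exact ((hasDerivAt_mittagLeffler_one_comp hρ.1 _ (ht2.trans hs)).const_mul _).mul_const _
  · refine (norm_mul_cos_le _ _).trans ?_
    rw [abs_mul]
    have hs : t / 2 < s := hs
    refine mul_le_mul_of_nonneg_left
      ((abs_sq_mul_relaxation_le hρ (ht2.trans hs) k).trans ?_) (abs_nonneg _)
    have := hρ.1
    gcongr
  · refine (summable_mul_of_abs_le (B := 1) hc fun k => ?_).of_norm_bounded
      fun k => norm_mul_cos_le _ _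
    have hz : 0 ≤ (k : ℝ) ^ 2 * t ^ ρ := mul_nonneg (sq_nonneg _) (Real.rpow_nonneg ht.le _)
    rw [neg_mul, abs_of_nonneg (mittagLeffler_one_neg_nonneg hρ hz)]
    exact mittagLeffler_one_neg_le_one hρ hz

theorem hasDerivAt_rlIntegral_cosSeries (hρ : ρ ∈ Ioo (0 : ℝ) 1) (hc : Summable fun k => |c k|)
    (x : ℝ) {t : ℝ} (ht : 0 < t) :
    HasDerivAt (rlIntegral (ρ - 1) (cosSeries ρ c x)) (cosSeriesDeriv₂ ρ c x t) t := by
  refine (hasDerivAt_cosSeriesIntegral hρ hc x ht).congr_of_eventuallyEq ?_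
  filter_upwards [Ioi_mem_nhds ht] with s hs
  exact rlIntegral_cosSeries hρ hc x hs

theorem cosSeriesIntegral_zero (hρ : ρ ≠ 0) (c : ℕ → ℝ) (x : ℝ) :
    cosSeriesIntegral ρ c x 0 = ∑' k : ℕ, c k * Real.cos (k * x) := by
  refine tsum_congr fun k => ?_
  rw [Real.zero_rpow hρ, mul_zero, mittagLeffler_zero, Real.Gamma_one, div_one, mul_one]

theorem isForwardSolution_cosSeries (hρ : ρ ∈ Ioo (0 : ℝ) 1) (hc : Summable fun k => |c k|)
    {φ : ℝ → ℝ} (hφ : ∀ x ∈ Icc 0 Real.pi, ∑' k : ℕ, c k * Real.cos (k * x) = φ x) :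
    IsForwardSolution ρ φ (cosSeries ρ c) where
  continuousOn := continuousOn_cosSeries hρ hc
  differentiableOn t ht x _ :=
    (hasDerivAt_cosSeries hρ hc ht x).differentiableAt.differentiableWithinAt
  differentiableOn₂ t ht := by
    refine DifferentiableOn.congr (f := fun x => cosSeriesDeriv ρ c x t) (fun x _ =>
      (hasDerivAt_cosSeriesDeriv hρ hc ht x).differentiableAt.differentiableWithinAt) ?_
    exact fun x hx => spaceDeriv_cosSeries hρ hc hx ht
  continuousOn_spaceDeriv₂ := (continuousOn_cosSeriesDeriv₂ hρ hc).congr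
    fun p hp => spaceDeriv₂_cosSeries hρ hc hp.1 hp.2
  rlIntegrable x hx t ht := rlIntegrable_cosSeries hρ hc hx ht
  continuousOn_rlIntegral := ⟨_, continuousOn_cosSeriesIntegral hρ hc,
    fun x _ t ht => (rlIntegral_cosSeries hρ hc x ht).symm⟩
  differentiableAt_rlIntegral x _ t ht :=
    (hasDerivAt_rlIntegral_cosSeries hρ hc x ht).differentiableAt
  continuousOn_rlDeriv := (continuousOn_cosSeriesDeriv₂ hρ hc).congr
    fun p hp => (hasDerivAt_rlIntegral_cosSeries hρ hc p.1 hp.2).deriv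
  equation x hx t ht := by
    rw [rlDeriv, (hasDerivAt_rlIntegral_cosSeries hρ hc x ht).deriv,
      spaceDeriv₂_cosSeries hρ hc (Ioo_subset_Icc_self hx) ht, sub_self]
  initial x hx := by
    have h : ContinuousWithinAt (cosSeriesIntegral ρ c x) (Ici 0) 0 :=
      ((continuousOn_cosSeriesIntegral hρ hc).comp (f := fun s => (x, s)) (by fun_prop)
        fun s hs => ⟨hx, hs⟩) 0 self_mem_Ici
    have h2 := h.tendsto.mono_left (nhdsWithin_mono 0 Ioi_subset_Ici_self)
    rw [cosSeriesIntegral_zero hρ.1.ne', hφ x hx] at h2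
    refine h2.congr' ?_
    filter_upwards [self_mem_nhdsWithin] with t ht
    exact (rlIntegral_cosSeries hρ hc x ht).symm
  neumann_zero t ht := by
    rw [spaceDeriv_cosSeries hρ hc ⟨le_rfl, Real.pi_pos.le⟩ ht]
    simp [cosSeriesDeriv]
  neumann_pi t ht := by
    rw [spaceDeriv_cosSeries hρ hc ⟨Real.pi_pos.le, le_rfl⟩ ht]
    simp [cosSeriesDeriv]

/-- Only the term `k = 0` contributes to the mean value in `x`. -/
theorem integral_cosSeries (hρ : ρ ∈ Ioo (0 : ℝ) 1) (hc : Summable fun k => |c k|) {t : ℝ}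
    (ht : 0 < t) :
    ∫ x in (0 : ℝ)..Real.pi, cosSeries ρ c x t =
      c 0 * Real.pi * (t ^ (ρ - 1) / Real.Gamma ρ) := by
  have h := integral_tsum_mul_cos_mul_cos (summable_mul_relaxation hρ hc ht) 0
  simp only [CharP.cast_eq_zero, zero_mul, Real.cos_zero, mul_one, cosNormSq, if_true] at h
  refine Eq.trans (intervalIntegral.integral_congr fun x _ => ?_) (h.trans ?_)
  · rfl
  · simp [relaxation, mittagLeffler_zero]
    ring

end Series

/-! ### Inversion of the fractional integral -/

/-- The convolution of the kernels of the fractional integrals of orders `1 - ρ` and `ρ` is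
constant. -/
theorem integral_kernel_mul_kernel {ρ ξ t : ℝ} (hρ : ρ ∈ Ioo (0 : ℝ) 1) (h : ξ < t) :
    IntegrableOn (fun τ => (τ - ξ) ^ (-ρ) * (t - τ) ^ (ρ - 1)) (Ioo ξ t) ∧
    ∫ τ in Ioo ξ t, (τ - ξ) ^ (-ρ) * (t - τ) ^ (ρ - 1) =
      Real.Gamma ρ * Real.Gamma (1 - ρ) := by
  have ht : 0 < t - ξ := sub_pos.2 h
  have hi := intervalIntegrable_beta_scaled (sub_pos.2 hρ.2) hρ.1 ht
  have hv := integral_beta_scaled (sub_pos.2 hρ.2) hρ.1 ht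
  rw [show (1 - ρ) - 1 = -ρ by ring] at hi hv
  have hi' := hi.comp_sub_right ξ
  have e : ∀ τ, (τ - ξ) ^ (-ρ) * (t - ξ - (τ - ξ)) ^ (ρ - 1) =
    (τ - ξ) ^ (-ρ) * (t - τ) ^ (ρ - 1) := fun τ => by rw [sub_sub_sub_cancel_right]
  have hs := intervalIntegral.integral_comp_sub_right (a := ξ) (b := t)
    (fun s => s ^ (-ρ) * (t - ξ - s) ^ (ρ - 1)) ξ
  rw [sub_self, hv] at hs
  simp only [e, zero_add, sub_add_cancel] at hi' hs
  rw [intervalIntegrable_iff_integrableOn_Ioo_of_le h.le] at hi'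
  refine ⟨hi', ?_⟩
  rw [intervalIntegral.integral_of_le h.le, integral_Ioc_eq_integral_Ioo] at hs
  rw [hs]
  simp [mul_comm]

/-- Abel's inversion: the fractional integral of order `ρ` of the one of order `1 - ρ` is the
primitive. This is Fubini's theorem together with `integral_kernel_mul_kernel`. -/
theorem rlIntegral_rlIntegral {ρ t : ℝ} (hρ : ρ ∈ Ioo (0 : ℝ) 1) (ht : 0 < t) {f : ℝ → ℝ}
    (hf : IntervalIntegrable f volume 0 t) :
    rlIntegral (-ρ) (rlIntegral (ρ - 1) f) t = ∫ s in (0 : ℝ)..t, f s := by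
  have hG0 := Real.Gamma_pos_of_pos hρ.1
  have hG1 := Real.Gamma_pos_of_pos (sub_pos.2 hρ.2)
  rw [intervalIntegrable_iff_integrableOn_Ioo_of_le ht.le] at hf
  set μ : Measure ℝ := volume.restrict (Ioo 0 t) with hμ
  let K : ℝ → ℝ → ℝ := fun τ ξ => (Ioi ξ).indicator
    (fun τ => (τ - ξ) ^ (-ρ) * (t - τ) ^ (ρ - 1)) τ
  have hKmeas : Measurable fun p : ℝ × ℝ => K p.1 p.2 := by
    have : (fun p : ℝ × ℝ => K p.1 p.2) = {p : ℝ × ℝ | p.2 < p.1}.indicator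
        (fun p => (p.1 - p.2) ^ (-ρ) * (t - p.1) ^ (ρ - 1)) := by
      funext p
      simp only [K, indicator, mem_Ioi, mem_ofPred_eq]
    rw [this]
    exact Measurable.indicator (by fun_prop) (measurableSet_lt measurable_snd measurable_fst)
  have hKnn : ∀ ξ, ∀ τ ∈ Ioo 0 t, 0 ≤ K τ ξ := by
    intro ξ τ hτ
    simp only [K, indicator, mem_Ioi]
    split_ifs with h
    · exact mul_nonneg (Real.rpow_nonneg (by linarith) _) (Real.rpow_nonneg (by linarith [hτ.2]) _)
    · exact le_rfl
  have hinter : ∀ ξ ∈ Ioo 0 t, Ioo 0 t ∩ Ioi ξ = Ioo ξ t := by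
    intro ξ hξ
    ext s
    simp only [mem_inter_iff, mem_Ioo, mem_Ioi]
    exact ⟨fun h => ⟨h.2, h.1.2⟩, fun h => ⟨⟨hξ.1.trans h.1, h.2⟩, h.1⟩⟩
  have hKint : ∀ ξ ∈ Ioo 0 t, Integrable (fun τ => K τ ξ) μ := by
    intro ξ hξ
    simp only [K]
    rw [integrable_indicator_iff measurableSet_Ioi, IntegrableOn, hμ,
      Measure.restrict_restrict measurableSet_Ioi, inter_comm, hinter ξ hξ]
    exact (integral_kernel_mul_kernel hρ hξ.2).1
  have hKval : ∀ ξ ∈ Ioo 0 t, ∫ τ, K τ ξ ∂μ = Real.Gamma ρ * Real.Gamma (1 - ρ) := by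
    intro ξ hξ
    simp only [K]
    rw [integral_indicator measurableSet_Ioi, hμ,
      Measure.restrict_restrict measurableSet_Ioi, inter_comm, hinter ξ hξ]
    exact (integral_kernel_mul_kernel hρ hξ.2).2
  have hint : Integrable (Function.uncurry fun τ ξ => f ξ * K τ ξ) (μ.prod μ) := by
    refine (integrable_prod_iff' ?_).2 ⟨?_, ?_⟩
    · exact (hf.aestronglyMeasurable.comp_snd).mul hKmeas.aestronglyMeasurable
    · filter_upwards [ae_restrict_mem measurableSet_Ioo] with ξ hξ
      exact (hKint ξ hξ).const_mul (f ξ)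
    · refine (hf.norm.mul_const (Real.Gamma ρ * Real.Gamma (1 - ρ))).congr ?_
      filter_upwards [ae_restrict_mem measurableSet_Ioo] with ξ hξ
      rw [← hKval ξ hξ, ← integral_const_mul]
      refine setIntegral_congr_fun measurableSet_Ioo fun τ hτ => ?_
      simp only [Function.uncurry_apply_pair, norm_mul, Real.norm_of_nonneg (hKnn ξ τ hτ)]
  have hswap := integral_integral_swap hint
  have hR : ∫ ξ, ∫ τ, f ξ * K τ ξ ∂μ ∂μ =
      Real.Gamma ρ * Real.Gamma (1 - ρ) * ∫ s in (0 : ℝ)..t, f s := by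
    rw [intervalIntegral.integral_of_le ht.le, integral_Ioc_eq_integral_Ioo, ← integral_const_mul]
    refine setIntegral_congr_fun measurableSet_Ioo fun ξ hξ => ?_
    rw [integral_const_mul, hKval ξ hξ, mul_comm]
  have hL : ∫ τ, ∫ ξ, f ξ * K τ ξ ∂μ ∂μ =
      Real.Gamma ρ * Real.Gamma (1 - ρ) * rlIntegral (-ρ) (rlIntegral (ρ - 1) f) t := by
    rw [rlIntegral, neg_neg, intervalIntegral.integral_of_le ht.le, integral_Ioc_eq_integral_Ioo,
      ← mul_assoc, show Real.Gamma ρ * Real.Gamma (1 - ρ) * (1 / Real.Gamma ρ) =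
        Real.Gamma (1 - ρ) by field_simp, ← integral_const_mul]
    refine setIntegral_congr_fun measurableSet_Ioo fun τ hτ => ?_
    simp only [rlIntegral]
    rw [intervalIntegral.integral_of_le hτ.1.le, integral_Ioc_eq_integral_Ioo,
      show -(ρ - 1) = 1 - ρ by ring]
    have e1 : ∀ ξ, f ξ * K τ ξ = (t - τ) ^ (ρ - 1) *
        (Iio τ).indicator (fun ξ => f ξ * (τ - ξ) ^ (-ρ)) ξ := by
      intro ξ
      simp only [K, indicator, mem_Ioi, mem_Iio]
      split_ifs <;> ring
    have e2 : Iio τ ∩ Ioo 0 t = Ioo 0 τ := by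
      ext s
      simp only [mem_inter_iff, mem_Ioo, mem_Iio]
      exact ⟨fun h => ⟨h.2.1, h.1⟩, fun h => ⟨h.2, h.1, h.2.trans hτ.2⟩⟩
    simp_rw [e1]
    rw [integral_const_mul, integral_indicator measurableSet_Iio, hμ,
      Measure.restrict_restrict measurableSet_Iio, e2]
    have e3 : ∫ ξ in Ioo 0 τ, f ξ * (τ - ξ) ^ (-ρ) =
        ∫ ξ in Ioo 0 τ, f ξ / (τ - ξ) ^ (ρ - 1 + 1) := by
      refine setIntegral_congr_fun measurableSet_Ioo fun ξ hξ => ?_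
      rw [sub_add_cancel, Real.rpow_neg (by linarith [hξ.2]), div_eq_mul_inv]
    have e4 : (t - τ) ^ (ρ - 1) = ((t - τ) ^ (-ρ + 1))⁻¹ := by
      rw [← Real.rpow_neg (by linarith [hτ.2])]
      congr 1
      ring
    rw [e3, e4]
    field_simp
  rw [hL, hR] at hswap
  exact mul_left_cancel₀ (by positivity) hswap

/-! ### Linear Volterra equations with the fractional kernel -/

/-- The kernel of the fractional integral of order `ρ` is the case of a constant function in
`intervalIntegrable_rpow_div`, with `1 - ρ` in place of `ρ`. -/
theorem intervalIntegrable_inv_kernel {ρ t : ℝ} (hρ : 0 < ρ) (ht : 0 < t) :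
    IntervalIntegrable (fun ξ : ℝ => 1 / (t - ξ) ^ (-ρ + 1)) volume 0 t := by
  have h := intervalIntegrable_rpow_div (ρ := 1 - ρ) one_pos (by linarith) ht
  simp only [sub_self, Real.rpow_zero, show 1 - ρ - 1 + 1 = -ρ + 1 by ring] at h
  exact h

theorem rlIntegrable_of_continuous {ρ t : ℝ} (hρ : 0 < ρ) (ht : 0 < t) {f : ℝ → ℝ}
    (hf : Continuous f) : RLIntegrable (-ρ) f t := by
  have := (intervalIntegrable_inv_kernel hρ ht).continuousOn_mul hf.continuousOn
  simpa [RLIntegrable, div_eq_mul_inv] using this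

theorem integral_inv_kernel {ρ t : ℝ} (hρ : 0 < ρ) (ht : 0 < t) :
    ∫ ξ in (0 : ℝ)..t, 1 / (t - ξ) ^ (-ρ + 1) = t ^ ρ / ρ := by
  have h := integral_rpow_div (ρ := 1 - ρ) one_pos (by linarith) ht
  simp only [sub_self, Real.rpow_zero, show 1 - ρ - 1 + 1 = -ρ + 1 by ring, sub_sub_cancel,
    Real.Gamma_one, one_mul] at h
  rw [h, add_comm, Real.Gamma_add_one hρ.ne']
  have := (Real.Gamma_pos_of_pos hρ).ne'
  field_simp

theorem abs_rlIntegral_le {ρ t : ℝ} (ht : 0 < t) (hρ : 0 < ρ) {f g : ℝ → ℝ}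
    (hg : Continuous g) (hfg : ∀ s ∈ Ioc 0 t, |f s| ≤ g s) :
    |rlIntegral (-ρ) f t| ≤ rlIntegral (-ρ) g t := by
  have hG := Real.Gamma_pos_of_pos hρ
  rw [rlIntegral, rlIntegral, neg_neg, abs_mul, abs_of_pos (one_div_pos.2 hG), ← Real.norm_eq_abs]
  refine mul_le_mul_of_nonneg_left ?_ (one_div_pos.2 hG).le
  refine intervalIntegral.norm_integral_le_of_norm_le ht.le ?_ (rlIntegrable_of_continuous hρ ht hg)
  refine Eventually.of_forall fun s hs => ?_
  have e : 0 ≤ (t - s) ^ (-ρ + 1) := Real.rpow_nonneg (by linarith [hs.2]) _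
  rw [norm_div, Real.norm_of_nonneg e]
  exact div_le_div_of_nonneg_right (hfg s hs) e

theorem rlIntegral_const {ρ t : ℝ} (hρ : 0 < ρ) (ht : 0 < t) (c : ℝ) :
    rlIntegral (-ρ) (fun _ => c) t = c * (t ^ ρ / ρ) / Real.Gamma ρ := by
  rw [rlIntegral, neg_neg, ← integral_inv_kernel hρ ht, ← intervalIntegral.integral_const_mul c]
  simp_rw [mul_one_div]
  ring

theorem rlIntegral_const_mul (α c : ℝ) (f : ℝ → ℝ) (t : ℝ) :
    rlIntegral α (fun s => c * f s) t = c * rlIntegral α f t := by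
  simp only [rlIntegral, mul_div_assoc]
  rw [intervalIntegral.integral_const_mul]
  ring

theorem tendsto_rlIntegral_nhdsGT_zero {ρ : ℝ} (hρ : 0 < ρ) {f : ℝ → ℝ} (hf : Continuous f) :
    Tendsto (rlIntegral (-ρ) f) (𝓝[>] 0) (𝓝 0) := by
  obtain ⟨C, hC⟩ := (isCompact_Icc (a := (0 : ℝ)) (b := 1)).exists_bound_of_continuousOn
    hf.continuousOn
  have hlim : Tendsto (fun t : ℝ => C * (t ^ ρ / ρ) / Real.Gamma ρ) (𝓝[>] 0) (𝓝 0) := by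
    have h := (tendsto_rpow_nhdsGT_zero hρ).mono_right nhdsWithin_le_nhds
    simpa using (((h.div_const ρ).const_mul C).div_const (Real.Gamma ρ))
  refine squeeze_zero_norm' ?_ hlim
  filter_upwards [Ioo_mem_nhdsGT (zero_lt_one' ℝ)] with t ht
  rw [← rlIntegral_const hρ ht.1]
  exact abs_rlIntegral_le ht.1 hρ continuous_const
    fun s hs => hC s ⟨hs.1.le, hs.2.trans ht.2.le⟩

/-- The fractional integral of order `ρ` is bounded by `A ^ (-ρ)` in the norm with the weight
`exp (-A t)`. -/
theorem rlIntegral_exp_le {ρ A t : ℝ} (hρ : 0 < ρ) (hA : 0 < A) (ht : 0 < t) :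
    rlIntegral (-ρ) (fun s => Real.exp (A * s)) t ≤ (1 / A) ^ ρ * Real.exp (A * t) := by
  have hG := Real.Gamma_pos_of_pos hρ
  have hval := Real.integral_rpow_mul_exp_neg_mul_Ioi hρ hA
  have hint : IntegrableOn (fun s : ℝ => s ^ (ρ - 1) * Real.exp (-(A * s))) (Ioi 0) := by
    by_contra hn
    rw [integral_undef hn] at hval
    have : 0 < (1 / A) ^ ρ * Real.Gamma ρ := by positivity
    exact this.ne hval
  have e1 : ∫ s in (0 : ℝ)..t, Real.exp (A * s) / (t - s) ^ (-ρ + 1) =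
      Real.exp (A * t) * ∫ s in (0 : ℝ)..t, s ^ (ρ - 1) * Real.exp (-(A * s)) := by
    rw [← intervalIntegral.integral_const_mul]
    have := intervalIntegral.integral_comp_sub_left (a := 0) (b := t)
      (fun s => Real.exp (A * t) * (s ^ (ρ - 1) * Real.exp (-(A * s)))) t
    rw [sub_self, sub_zero] at this
    rw [← this]
    refine intervalIntegral.integral_congr fun s hs => ?_
    rw [uIcc_of_le ht.le] at hs
    rw [show ρ - 1 = -(-ρ + 1) by ring, Real.rpow_neg (by linarith [hs.2]), mul_left_comm,
      ← Real.exp_add, div_eq_inv_mul]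
    congr 2
    ring
  have e2 : ∫ s in (0 : ℝ)..t, s ^ (ρ - 1) * Real.exp (-(A * s)) ≤ (1 / A) ^ ρ * Real.Gamma ρ := by
    rw [← hval, intervalIntegral.integral_of_le ht.le]
    refine setIntegral_mono_set hint ?_ Ioc_subset_Ioi_self.eventuallyLE
    filter_upwards [ae_restrict_mem measurableSet_Ioi] with s hs
    exact mul_nonneg (Real.rpow_nonneg (le_of_lt hs) _) (Real.exp_pos _).le
  rw [rlIntegral, neg_neg, e1, one_div_mul_eq_div, div_le_iff₀ hG]
  calc Real.exp (A * t) * ∫ s in (0 : ℝ)..t, s ^ (ρ - 1) * Real.exp (-(A * s)) ≤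
      Real.exp (A * t) * ((1 / A) ^ ρ * Real.Gamma ρ) :=
        mul_le_mul_of_nonneg_left e2 (Real.exp_pos _).le
    _ = _ := by ring

theorem eq_zero_of_eq_neg_mul_rlIntegral {ρ l : ℝ} (hρ : 0 < ρ) (hl : 0 ≤ l) {D : ℝ → ℝ}
    (hD : Continuous D) (hD0 : D 0 = 0) (heq : ∀ t > 0, D t = -l * rlIntegral (-ρ) D t) :
    ∀ t ≥ 0, D t = 0 := by
  intro T hT
  -- with this `A` the Volterra operator has norm at most `1 / 2` in the weighted norm
  set A : ℝ := (2 * l + 1) ^ ρ⁻¹ with hA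
  have hApos : 0 < A := Real.rpow_pos_of_pos (by positivity) _
  have hAρ : l * (1 / A) ^ ρ ≤ 1 / 2 := by
    rw [Real.div_rpow zero_le_one hApos.le, Real.one_rpow, hA,
      Real.rpow_inv_rpow (by positivity) hρ.ne', mul_one_div, div_le_div_iff₀ (by positivity)
      two_pos]
    linarith
  obtain ⟨t, ht, hmax⟩ := isCompact_Icc.exists_isMaxOn (nonempty_Icc.2 hT)
    (f := fun s => Real.exp (-(A * s)) * |D s|) (by fun_prop)
  have hM : Real.exp (-(A * t)) * |D t| ≤ 0 := by
    rcases ht.1.eq_or_lt with h0 | h0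
    · simp [← h0, hD0]
    set m := Real.exp (-(A * t)) * |D t| with hm
    have hm0 : 0 ≤ m := by positivity
    have hb : ∀ s ∈ Ioc 0 t, |D s| ≤ m * Real.exp (A * s) := by
      intro s hs
      have := mul_le_mul_of_nonneg_right (hmax (show s ∈ Icc 0 T from ⟨hs.1.le, hs.2.trans ht.2⟩))
        (Real.exp_pos (A * s)).le
      simp only at this
      rw [mul_right_comm, ← Real.exp_add] at this
      simpa using this
    have h1 := abs_rlIntegral_le (f := D) h0 hρ (g := fun s => m * Real.exp (A * s)) (by fun_prop) hb
    rw [rlIntegral_const_mul] at h1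
    have h2 := h1.trans (mul_le_mul_of_nonneg_left (rlIntegral_exp_le hρ hApos h0) hm0)
    have h3 : |D t| ≤ l * (m * ((1 / A) ^ ρ * Real.exp (A * t))) := by
      rw [heq t h0, abs_mul, abs_neg, abs_of_nonneg hl]
      exact mul_le_mul_of_nonneg_left h2 hl
    have h4 : m ≤ 1 / 2 * m := by
      calc m ≤ Real.exp (-(A * t)) * (l * (m * ((1 / A) ^ ρ * Real.exp (A * t)))) :=
            mul_le_mul_of_nonneg_left h3 (Real.exp_pos _).le
        _ = l * (1 / A) ^ ρ * m * (Real.exp (-(A * t)) * Real.exp (A * t)) := by ring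
        _ = l * (1 / A) ^ ρ * m := by rw [← Real.exp_add]; simp
        _ ≤ 1 / 2 * m := mul_le_mul_of_nonneg_right hAρ hm0
    linarith
  have h5 : Real.exp (-(A * T)) * |D T| ≤ 0 := (hmax (show T ∈ Icc 0 T from ⟨hT, le_rfl⟩)).trans hM
  have h6 : |D T| ≤ 0 := nonpos_of_mul_nonpos_right h5 (Real.exp_pos _)
  exact abs_nonpos_iff.1 h6

/-! ### Uniqueness for the forward problem -/

theorem rlIntegral_congr {α t : ℝ} {f g : ℝ → ℝ} (ht : 0 ≤ t) (h : ∀ s ∈ Ioc 0 t, f s = g s) :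
    rlIntegral α f t = rlIntegral α g t := by
  rw [rlIntegral, rlIntegral, intervalIntegral.integral_of_le ht,
    intervalIntegral.integral_of_le ht]
  congr 1
  exact setIntegral_congr_fun measurableSet_Ioc fun s hs => by simp only [h s hs]

/-- Extension by clamping the arguments. -/
theorem exists_continuous_extension {F : ℝ × ℝ → ℝ} {a b s : ℝ} (hab : a ≤ b)
    (hF : ContinuousOn F (Icc a b ×ˢ Ici s)) :
    ∃ g : ℝ → ℝ → ℝ, Continuous (Function.uncurry g) ∧
      ∀ x ∈ Icc a b, ∀ t ≥ s, g x t = F (x, t) := by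
  refine ⟨fun x t => F (max a (min x b), max t s), ?_, fun x hx t ht => ?_⟩
  · exact hF.comp_continuous (f := fun p : ℝ × ℝ => (max a (min p.1 b), max p.2 s)) (by fun_prop)
      fun p => ⟨⟨le_max_left _ _, max_le hab (min_le_right _ _)⟩, le_max_right p.2 s⟩
  · simp only [min_eq_left hx.2, max_eq_right hx.1, max_eq_left ht]

theorem integral_integral_swap_of_continuousOn {F : ℝ → ℝ → ℝ} {a b s t : ℝ} (hab : a ≤ b)
    (hst : s ≤ t) (hF : ContinuousOn (fun p : ℝ × ℝ => F p.1 p.2) (Icc a b ×ˢ Icc s t)) :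
    ∫ τ in s..t, ∫ x in a..b, F x τ = ∫ x in a..b, ∫ τ in s..t, F x τ := by
  refine (intervalIntegral_intervalIntegral_swap (F := F) ?_).symm
  rw [uIoc_of_le hab, uIoc_of_le hst]
  exact (hF.integrableOn_compact (isCompact_Icc.prod isCompact_Icc)).mono_set
    (prod_mono Ioc_subset_Icc_self Ioc_subset_Icc_self)

/-- The fractional integral commutes with integration over a parameter. -/
theorem integral_rlIntegral {ρ t a b : ℝ} (hρ : 0 < ρ) (ht : 0 < t) (hab : a ≤ b)
    {F : ℝ → ℝ → ℝ} (hF : Continuous (Function.uncurry F)) :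
    IntervalIntegrable (fun x => rlIntegral (-ρ) (F x) t) volume a b ∧
    ∫ x in a..b, rlIntegral (-ρ) (F x) t =
      rlIntegral (-ρ) (fun τ => ∫ x in a..b, F x τ) t := by
  have hk := (intervalIntegrable_iff_integrableOn_Ioc_of_le ht.le).1
    (intervalIntegrable_inv_kernel hρ ht)
  have hone : IntegrableOn (fun _ : ℝ => (1 : ℝ)) (Ioc a b) := by simp
  obtain ⟨C, hC⟩ := ((isCompact_Icc (a := a) (b := b)).prod
    (isCompact_Icc (a := (0 : ℝ)) (b := t))).exists_bound_of_continuousOn hF.continuousOn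
  have hint : Integrable (Function.uncurry fun x τ => F x τ / (t - τ) ^ (-ρ + 1))
      ((volume.restrict (Ioc a b)).prod (volume.restrict (Ioc 0 t))) := by
    refine ((Integrable.mul_prod hone hk).bdd_mul (c := C) hF.aestronglyMeasurable ?_).congr
      (Eventually.of_forall fun p => ?_)
    · rw [Measure.prod_restrict]
      filter_upwards [ae_restrict_mem (measurableSet_Ioc.prod measurableSet_Ioc)] with p hp
      exact hC p ⟨Ioc_subset_Icc_self hp.1, Ioc_subset_Icc_self hp.2⟩
    · simp only [Function.uncurry, mul_one_div]
  have hswap := integral_integral_swap hint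
  constructor
  · rw [intervalIntegrable_iff_integrableOn_Ioc_of_le hab]
    simp only [rlIntegral, intervalIntegral.integral_of_le ht.le]
    exact hint.integral_prod_left.const_mul _
  · simp only [rlIntegral, intervalIntegral.integral_of_le ht.le,
      intervalIntegral.integral_of_le hab]
    rw [integral_const_mul, hswap]
    simp_rw [integral_div]

section Forward

variable {ρ : ℝ} {φ : ℝ → ℝ} {v : ℝ → ℝ → ℝ}

theorem IsForwardSolution.integral_spaceDeriv₂_mul_cos (hv : IsForwardSolution ρ φ v) (k : ℕ)
    {t : ℝ} (ht : 0 < t) :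
    ∫ x in (0 : ℝ)..Real.pi, spaceDeriv₂ v x t * Real.cos (k * x) =
      -(k : ℝ) ^ 2 * ∫ x in (0 : ℝ)..Real.pi, v x t * Real.cos (k * x) := by
  have hpi := Real.pi_pos
  have hc2 : ContinuousOn (fun x => spaceDeriv₂ v x t) (Icc 0 Real.pi) :=
    hv.continuousOn_spaceDeriv₂.comp (f := fun x => (x, t)) (by fun_prop) fun x hx => ⟨hx, ht⟩
  have hd1 := hv.differentiableOn t ht
  have hd2 := hv.differentiableOn₂ t ht
  have hcos : ∀ x : ℝ, HasDerivAt (fun x : ℝ => Real.cos (k * x)) (-(k * Real.sin (k * x))) x := by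
    intro x
    refine ((hasDerivAt_id x).const_mul (k : ℝ)).cos.congr_deriv ?_
    simp only [id]
    ring
  have hsin : ∀ x : ℝ, HasDerivAt (fun x : ℝ => Real.sin (k * x)) (k * Real.cos (k * x)) x := by
    intro x
    refine ((hasDerivAt_id x).const_mul (k : ℝ)).sin.congr_deriv ?_
    simp only [id]
    ring
  have h1 := intervalIntegral.integral_mul_deriv_eq_deriv_mul_of_hasDerivAt
    (a := 0) (b := Real.pi) (u := fun x => Real.cos (k * x)) (v := fun x => spaceDeriv v x t)
    (u' := fun x => -(k * Real.sin (k * x))) (v' := fun x => spaceDeriv₂ v x t)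
    (by fun_prop) (by rw [uIcc_of_le hpi.le]; exact hd2.continuousOn) (fun x _ => hcos x)
    (fun x hx => by
      rw [min_eq_left hpi.le, max_eq_right hpi.le] at hx
      exact (hd2 x (Ioo_subset_Icc_self hx)).hasDerivWithinAt.hasDerivAt (Icc_mem_nhds hx.1 hx.2))
    (Continuous.intervalIntegrable (by fun_prop) _ _) (hc2.intervalIntegrable_of_Icc hpi.le)
  have h2 := intervalIntegral.integral_mul_deriv_eq_deriv_mul_of_hasDerivAt
    (a := 0) (b := Real.pi) (u := fun x => Real.sin (k * x)) (v := fun x => v x t)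
    (u' := fun x => k * Real.cos (k * x)) (v' := fun x => spaceDeriv v x t)
    (by fun_prop) (by rw [uIcc_of_le hpi.le]; exact hd1.continuousOn) (fun x _ => hsin x)
    (fun x hx => by
      rw [min_eq_left hpi.le, max_eq_right hpi.le] at hx
      exact (hd1 x (Ioo_subset_Icc_self hx)).hasDerivWithinAt.hasDerivAt (Icc_mem_nhds hx.1 hx.2))
    (Continuous.intervalIntegrable (by fun_prop) _ _)
    (hd2.continuousOn.intervalIntegrable_of_Icc hpi.le)
  simp only [hv.neumann_zero t ht, hv.neumann_pi t ht, mul_zero, sub_zero, zero_sub, neg_mul,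
    intervalIntegral.integral_neg, neg_neg, mul_assoc, intervalIntegral.integral_const_mul] at h1
  simp only [Real.sin_nat_mul_pi, mul_zero, Real.sin_zero, zero_mul, sub_zero, zero_sub, mul_assoc,
    intervalIntegral.integral_const_mul] at h2
  simp_rw [mul_comm (spaceDeriv₂ v _ t), mul_comm (v _ t)]
  rw [h1, h2]
  ring

/-- The cosine moments of a solution. With `G(t) = ∫ ∂_t^(ρ - 1) v(x, t) cos (k x) dx`, the
equation becomes `G' = -k² w` for the cosine moment `w` of `v`, while Abel's inversion expresses
the primitive of `w` as the fractional integral of `G`. Working with primitives in `t` avoids any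
integrability of `v` that is uniform in `x` near `t = 0`. -/
theorem IsForwardSolution.exists_cos_moment (hρ : ρ ∈ Ioo (0 : ℝ) 1)
    (hv : IsForwardSolution ρ φ v) (k : ℕ) :
    ∃ G : ℝ → ℝ, Continuous G ∧ (G 0 = ∫ x in (0 : ℝ)..Real.pi, φ x * Real.cos (k * x)) ∧
      (∀ t > 0, G t = G 0 - (k : ℝ) ^ 2 * rlIntegral (-ρ) G t) ∧
      ∀ s t, 0 < s → s ≤ t → ∫ τ in s..t, ∫ x in (0 : ℝ)..Real.pi, v x τ * Real.cos (k * x) =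
        rlIntegral (-ρ) G t - rlIntegral (-ρ) G s := by
  have hpi := Real.pi_pos
  obtain ⟨g₀, hg₀, hg₀eq⟩ := hv.continuousOn_rlIntegral
  obtain ⟨g, hg, hgeq⟩ := exists_continuous_extension hpi.le hg₀
  have hgv : ∀ x ∈ Icc 0 Real.pi, ∀ t > 0, g x t = rlIntegral (ρ - 1) (v x) t :=
    fun x hx t ht => (hgeq x hx t (le_of_lt ht)).trans (hg₀eq x hx t ht)
  have hgx : ∀ x, Continuous (g x) := fun x => hg.comp (by fun_prop : Continuous fun t => (x, t))
  have hg0 : ∀ x ∈ Icc 0 Real.pi, g x 0 = φ x := by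
    intro x hx
    refine tendsto_nhds_unique (((hgx x).tendsto 0).mono_left nhdsWithin_le_nhds)
      ((hv.initial x hx).congr' ?_)
    filter_upwards [self_mem_nhdsWithin] with t ht using (hgv x hx t ht).symm
  have hF : Continuous (Function.uncurry fun x t => Real.cos (k * x) * g x t) :=
    Continuous.mul (by fun_prop) hg
  set G : ℝ → ℝ := fun t => ∫ x in (0 : ℝ)..Real.pi, Real.cos (k * x) * g x t with hG
  have hGc : Continuous G := by
    refine intervalIntegral.continuous_parametric_intervalIntegral_of_continuous' (μ := volume)
      (f := fun t x => Real.cos (k * x) * g x t) ?_ 0 Real.pi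
    exact hF.comp continuous_swap
  have hprim : ∀ x ∈ Icc 0 Real.pi, ∀ t > 0,
      IntervalIntegrable (v x) volume 0 t ∧ rlIntegral (-ρ) (g x) t = ∫ s in (0 : ℝ)..t, v x s := by
    intro x hx t ht
    have hi := (hv.rlIntegrable x hx t ht).intervalIntegrable hρ.1 (le_of_lt ht)
    refine ⟨hi, ?_⟩
    rw [← rlIntegral_rlIntegral hρ ht hi]
    exact rlIntegral_congr (le_of_lt ht) fun s hs => hgv x hx s hs.1
  -- the primitive of the moment of `v`
  have hA : ∀ s t, 0 < s → s ≤ t →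
      ∫ τ in s..t, ∫ x in (0 : ℝ)..Real.pi, v x τ * Real.cos (k * x) =
        rlIntegral (-ρ) G t - rlIntegral (-ρ) G s := by
    intro s t hs hst
    have ht : 0 < t := hs.trans_le hst
    have hsw := integral_integral_swap_of_continuousOn (F := fun x τ => v x τ * Real.cos (k * x))
      hpi.le hst ((hv.continuousOn.mono (prod_mono subset_rfl
        fun τ hτ => hs.trans_le hτ.1)).mul (by fun_prop))
    obtain ⟨i1, e1⟩ := integral_rlIntegral hρ.1 ht hpi.le hF
    obtain ⟨i2, e2⟩ := integral_rlIntegral hρ.1 hs hpi.le hF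
    rw [hsw, hG, ← e1, ← e2, ← intervalIntegral.integral_sub i1 i2]
    refine intervalIntegral.integral_congr fun x hx => ?_
    rw [uIcc_of_le hpi.le] at hx
    obtain ⟨it, et⟩ := hprim x hx t ht
    obtain ⟨is, es⟩ := hprim x hx s hs
    simp only [rlIntegral_const_mul]
    rw [et, es, intervalIntegral.integral_mul_const, ← mul_sub,
      intervalIntegral.integral_interval_sub_left it is, mul_comm]
  -- the equation, integrated over `[s, t] × [0, π]`
  have hB : ∀ s t, 0 < s → s ≤ t → G t - G s =
      -(k : ℝ) ^ 2 * ∫ τ in s..t, ∫ x in (0 : ℝ)..Real.pi, v x τ * Real.cos (k * x) := by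
    intro s t hs hst
    have hsw := integral_integral_swap_of_continuousOn
      (F := fun x τ => spaceDeriv₂ v x τ * Real.cos (k * x))
      hpi.le hst ((hv.continuousOn_spaceDeriv₂.mono (prod_mono subset_rfl
        fun τ hτ => hs.trans_le hτ.1)).mul (by fun_prop))
    have hparts : ∫ τ in s..t, ∫ x in (0 : ℝ)..Real.pi, spaceDeriv₂ v x τ * Real.cos (k * x) =
        -(k : ℝ) ^ 2 * ∫ τ in s..t, ∫ x in (0 : ℝ)..Real.pi, v x τ * Real.cos (k * x) := by
      rw [← intervalIntegral.integral_const_mul]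
      refine intervalIntegral.integral_congr fun τ hτ => ?_
      rw [uIcc_of_le hst] at hτ
      exact hv.integral_spaceDeriv₂_mul_cos k (hs.trans_le hτ.1)
    have hcont : ∀ τ, Continuous fun x => Real.cos (k * x) * g x τ := fun τ =>
      hF.comp (by fun_prop : Continuous fun x : ℝ => (x, τ))
    rw [← hparts, hsw, hG, ← intervalIntegral.integral_sub ((hcont t).intervalIntegrable _ _)
      ((hcont s).intervalIntegrable _ _), intervalIntegral.integral_of_le hpi.le,
      intervalIntegral.integral_of_le hpi.le, integral_Ioc_eq_integral_Ioo,
      integral_Ioc_eq_integral_Ioo]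
    refine setIntegral_congr_fun measurableSet_Ioo fun x hx => ?_
    have hx' := Ioo_subset_Icc_self hx
    have hd : ∀ τ ∈ uIcc s t, HasDerivAt (g x) (spaceDeriv₂ v x τ) τ := by
      intro τ hτ
      rw [uIcc_of_le hst] at hτ
      have hτ0 : 0 < τ := hs.trans_le hτ.1
      have h := (hv.differentiableAt_rlIntegral x hx' τ hτ0).hasDerivAt
      rw [show deriv (rlIntegral (ρ - 1) (v x)) τ = spaceDeriv₂ v x τ from
        sub_eq_zero.1 (hv.equation x hx τ hτ0)] at h
      refine h.congr_of_eventuallyEq ?_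
      filter_upwards [Ioi_mem_nhds hτ0] with r hr using hgv x hx' r hr
    have hc2 : ContinuousOn (fun τ => spaceDeriv₂ v x τ) (Icc s t) :=
      hv.continuousOn_spaceDeriv₂.comp (f := fun τ => (x, τ)) (by fun_prop)
        fun τ hτ => ⟨hx', hs.trans_le hτ.1⟩
    rw [intervalIntegral.integral_mul_const, intervalIntegral.integral_eq_sub_of_hasDerivAt hd
      (hc2.intervalIntegrable_of_Icc hst)]
    ring
  refine ⟨G, hGc, ?_, ?_, hA⟩
  · refine intervalIntegral.integral_congr fun x hx => ?_
    rw [uIcc_of_le hpi.le] at hx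
    simp only [hg0 x hx, mul_comm]
  · intro t ht
    have h1 : Tendsto (fun s => G t - G s) (𝓝[>] 0) (𝓝 (G t - G 0)) :=
      tendsto_const_nhds.sub ((hGc.tendsto 0).mono_left nhdsWithin_le_nhds)
    have h2 : Tendsto (fun s => -(k : ℝ) ^ 2 * (rlIntegral (-ρ) G t - rlIntegral (-ρ) G s))
        (𝓝[>] 0) (𝓝 (-(k : ℝ) ^ 2 * (rlIntegral (-ρ) G t - 0))) :=
      (tendsto_const_nhds.sub (tendsto_rlIntegral_nhdsGT_zero hρ.1 hGc)).const_mul _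
    have h3 : G t - G 0 = -(k : ℝ) ^ 2 * (rlIntegral (-ρ) G t - 0) := by
      refine tendsto_nhds_unique h1 (h2.congr' ?_)
      filter_upwards [Ioo_mem_nhdsGT ht] with s hs
      rw [hB s t hs.1 hs.2.le, hA s t hs.1 hs.2.le]
    linarith

theorem IsForwardSolution.continuousOn_cos_moment (hv : IsForwardSolution ρ φ v) (k : ℕ) :
    ContinuousOn (fun t => ∫ x in (0 : ℝ)..Real.pi, v x t * Real.cos (k * x)) (Ioi 0) := by
  intro t ht
  have ht2 : 0 < t / 2 := half_pos ht
  obtain ⟨g, hg, hgeq⟩ := exists_continuous_extension Real.pi_pos.le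
    (hv.continuousOn.mono (prod_mono subset_rfl (Ici_subset_Ioi.2 ht2)))
  have hc : Continuous fun t => ∫ x in (0 : ℝ)..Real.pi, g x t * Real.cos (k * x) := by
    refine intervalIntegral.continuous_parametric_intervalIntegral_of_continuous' (μ := volume)
      (f := fun t x => g x t * Real.cos (k * x)) ?_ 0 Real.pi
    exact (hg.comp continuous_swap).mul (by fun_prop)
  refine (hc.continuousAt.congr ?_).continuousWithinAt
  filter_upwards [Ioi_mem_nhds (half_lt_self ht)] with s hs
  refine intervalIntegral.integral_congr fun x hx => ?_
  rw [uIcc_of_le Real.pi_pos.le] at hx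
  simp only [hgeq x hx s (le_of_lt hs)]

theorem eq_of_forall_integral_eq {f g : ℝ → ℝ} (hf : ContinuousOn f (Ioi 0))
    (hg : ContinuousOn g (Ioi 0))
    (h : ∀ s t, 0 < s → s ≤ t → ∫ τ in s..t, f τ = ∫ τ in s..t, g τ) {t : ℝ} (ht : 0 < t) :
    f t = g t := by
  have hderiv : ∀ {f : ℝ → ℝ}, ContinuousOn f (Ioi 0) →
      HasDerivWithinAt (fun r => ∫ τ in (t / 2)..r, f τ) (f t) (Ici t) t := by
    intro f hf
    have ht2 : t / 2 ≤ t := by linarith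
    refine (intervalIntegral.integral_hasDerivAt_right ?_ ?_ ?_).hasDerivWithinAt
    · exact (hf.mono fun r hr => (half_pos ht).trans_le hr.1).intervalIntegrable_of_Icc ht2
    · exact hf.stronglyMeasurableAtFilter isOpen_Ioi t ht
    · exact hf.continuousAt (Ioi_mem_nhds ht)
  refine (uniqueDiffOn_Ici t t self_mem_Ici).eq_deriv _ (hderiv hf) ((hderiv hg).congr ?_ ?_)
  · intro r hr
    exact h _ _ (half_pos ht) ((half_lt_self ht).le.trans hr)
  · exact h _ _ (half_pos ht) (half_lt_self ht).le

theorem IsForwardSolution.unique (hρ : ρ ∈ Ioo (0 : ℝ) 1) {u : ℝ → ℝ → ℝ}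
    (hv : IsForwardSolution ρ φ v) (hu : IsForwardSolution ρ φ u) :
    ∀ x ∈ Icc 0 Real.pi, ∀ t > 0, v x t = u x t := by
  intro x hx t ht
  have hslice : ∀ {w : ℝ → ℝ → ℝ}, IsForwardSolution ρ φ w →
      ContinuousOn (fun x => w x t) (Icc 0 Real.pi) := fun hw =>
    hw.continuousOn.comp (f := fun x => (x, t)) (by fun_prop) fun x hx => ⟨hx, ht⟩
  refine sub_eq_zero.1 (eq_zero_of_integral_mul_cos_eq_zero (h := fun x => v x t - u x t)
    ((hslice hv).sub (hslice hu)) (fun k => ?_) x hx)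
  simp_rw [sub_mul]
  rw [intervalIntegral.integral_sub ((hslice hv).intervalIntegrable_mul_zero_pi (by fun_prop))
    ((hslice hu).intervalIntegrable_mul_zero_pi (by fun_prop)), sub_eq_zero]
  refine eq_of_forall_integral_eq (hv.continuousOn_cos_moment k) (hu.continuousOn_cos_moment k)
    (fun s t hs hst => ?_) ht
  obtain ⟨G, hG, hG0, hGeq, hGint⟩ := hv.exists_cos_moment hρ k
  obtain ⟨H, hH, hH0, hHeq, hHint⟩ := hu.exists_cos_moment hρ k
  have hGH : ∀ t ≥ 0, G t - H t = 0 := by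
    refine eq_zero_of_eq_neg_mul_rlIntegral hρ.1 (sq_nonneg (k : ℝ)) (hG.sub hH) ?_ fun t ht => ?_
    · rw [hG0, hH0, sub_self]
    · rw [rlIntegral_sub (rlIntegrable_of_continuous hρ.1 ht hG)
        (rlIntegrable_of_continuous hρ.1 ht hH), hGeq t ht, hHeq t ht, hG0, hH0]
      ring
  have hcongr : ∀ r > 0, rlIntegral (-ρ) G r = rlIntegral (-ρ) H r := fun r hr =>
    rlIntegral_congr (le_of_lt hr) fun s hs => sub_eq_zero.1 (hGH s hs.1.le)
  rw [hGint s t hs hst, hHint s t hs hst, hcongr t (hs.trans_le hst), hcongr s hs]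

end Forward

/-! ### Determination of the order and the inverse problem -/

theorem continuousOn_rpow_div_Gamma {t₀ : ℝ} (ht₀ : 0 < t₀) :
    ContinuousOn (fun σ : ℝ => t₀ ^ (σ - 1) / Real.Gamma σ) (Ioi 0) := by
  intro σ hσ
  have hσ : 0 < σ := hσ
  refine ContinuousAt.continuousWithinAt (ContinuousAt.div ?_ ?_ (Real.Gamma_pos_of_pos hσ).ne')
  · exact (Real.continuous_const_rpow ht₀.ne').continuousAt.comp (by fun_prop)
  · refine (Real.differentiableAt_Gamma fun m => ?_).continuousAt
    have : (0 : ℝ) ≤ m := Nat.cast_nonneg m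
    linarith

/-- For `t₀ ≥ 1` both factors `t₀ ^ (σ - 1)` and `1 / Γ(σ)` increase on `(0, 1]`. -/
theorem strictMonoOn_rpow_div_Gamma {t₀ : ℝ} (ht₀ : 1 ≤ t₀) :
    StrictMonoOn (fun σ : ℝ => t₀ ^ (σ - 1) / Real.Gamma σ) (Ioc 0 1) := by
  intro a ha b hb hab
  have hΓ := Real.Gamma_strictAntiOn_Ioc ha hb hab
  have hΓb := Real.Gamma_pos_of_pos hb.1
  have hpow : t₀ ^ (a - 1) ≤ t₀ ^ (b - 1) :=
    Real.rpow_le_rpow_of_exponent_le ht₀ (by linarith)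
  have hpos : 0 < t₀ ^ (a - 1) := Real.rpow_pos_of_pos (by linarith) _
  simp only
  calc t₀ ^ (a - 1) / Real.Gamma a < t₀ ^ (a - 1) / Real.Gamma b :=
        div_lt_div_of_pos_left hpos hΓb hΓ
    _ ≤ t₀ ^ (b - 1) / Real.Gamma b := by gcongr

theorem exists_rpow_div_Gamma_eq {t₀ q : ℝ} (ht₀ : 1 ≤ t₀) (hq0 : 0 < q) (hq1 : q < 1) :
    ∃ ρ ∈ Ioo (0 : ℝ) 1, t₀ ^ (ρ - 1) / Real.Gamma ρ = q := by
  set a : ℝ := q / 3 with ha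
  have ha0 : 0 < a := by positivity
  have ha1 : a < 1 := by linarith
  -- `1 / Γ(a) = a / Γ(a + 1)` and `Γ(a + 1) ≥ e⁻¹ > 1 / 3`, hence `1 / Γ(a) < 3 a = q`
  have hval : t₀ ^ (a - 1) / Real.Gamma a < q := by
    have hΓ := Real.Gamma_pos_of_pos ha0
    have h1 := rpow_mul_exp_le_Gamma one_pos (by linarith : 1 ≤ a + 1)
    rw [Real.one_rpow, one_mul, Real.Gamma_add_one ha0.ne', Real.exp_neg] at h1
    have h2 : (1 : ℝ) / 3 < (Real.exp 1)⁻¹ := by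
      rw [one_div]
      exact inv_strictAnti₀ (Real.exp_pos 1) (Real.exp_one_lt_three)
    have h3 : t₀ ^ (a - 1) ≤ 1 := Real.rpow_le_one_of_one_le_of_nonpos ht₀ (by linarith)
    rw [div_lt_iff₀ hΓ, show q = 3 * a by rw [ha]; ring]
    linarith
  have hcont : ContinuousOn (fun σ : ℝ => t₀ ^ (σ - 1) / Real.Gamma σ) (Icc a 1) :=
    (continuousOn_rpow_div_Gamma (by linarith)).mono fun σ hσ => ha0.trans_le hσ.1
  have h1 : t₀ ^ ((1 : ℝ) - 1) / Real.Gamma 1 = 1 := by simp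
  obtain ⟨ρ, hρ, hρq⟩ := intermediate_value_Ioo ha1.le hcont ⟨hval, by simpa using hq1⟩
  exact ⟨ρ, ⟨ha0.trans hρ.1, hρ.2⟩, hρq⟩

theorem theorem4p2 (φ : ℝ → ℝ) (hφ : ContDiffOn ℝ 1 φ (Icc 0 Real.pi))
    (hφ0 : derivWithin φ (Icc 0 Real.pi) 0 = 0)
    (hφπ : derivWithin φ (Icc 0 Real.pi) Real.pi = 0)
    (t₀ d₀ φ₁ : ℝ) (ht₀ : 1 ≤ t₀) (hφ₁ : φ₁ = ∫ x in (0 : ℝ)..Real.pi, φ x)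
    (hpos : 0 < d₀ / φ₁) (hlt : d₀ / φ₁ < 1) :
    ∃ (u : ℝ → ℝ → ℝ) (ρ : ℝ),
      IsInverseSolution φ t₀ d₀ u ρ ∧
      (∀ (v : ℝ → ℝ → ℝ) (σ : ℝ), IsInverseSolution φ t₀ d₀ v σ →
        σ = ρ ∧ ∀ x ∈ Icc 0 Real.pi, ∀ t > 0, v x t = u x t) ∧
      (t₀ ^ (ρ - 1) / Real.Gamma ρ = d₀ / φ₁ ∧
        ∀ σ ∈ Ioo (0 : ℝ) 1, t₀ ^ (σ - 1) / Real.Gamma σ = d₀ / φ₁ → σ = ρ) ∧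
      ∀ x ∈ Icc 0 Real.pi, ∀ t > 0,
        HasSum (fun k : ℕ => cosCoeff φ k * t ^ (ρ - 1) *
          mittagLeffler ρ ρ (-(k : ℝ) ^ 2 * t ^ ρ) * Real.cos (k * x)) (u x t) := by
  have hφ₁0 : φ₁ ≠ 0 := by
    rintro rfl
    simp at hpos
  have ht₀pos : 0 < t₀ := by linarith
  have hc := summable_abs_cosCoeff hφ
  have hsol : ∀ {σ : ℝ}, σ ∈ Ioo (0 : ℝ) 1 → IsForwardSolution σ φ (cosSeries σ (cosCoeff φ)) :=
    fun hσ => isForwardSolution_cosSeries hσ hc (tsum_cosCoeff_mul_cos hφ)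
  have hmean : ∀ {σ : ℝ}, σ ∈ Ioo (0 : ℝ) 1 →
      ∫ x in (0 : ℝ)..Real.pi, cosSeries σ (cosCoeff φ) x t₀ =
        φ₁ * (t₀ ^ (σ - 1) / Real.Gamma σ) := by
    intro σ hσ
    have h0 := integral_mul_cos_eq_cosCoeff φ 0
    simp only [Nat.cast_zero, zero_mul, Real.cos_zero, mul_one, cosNormSq, if_true] at h0
    rw [integral_cosSeries hσ hc ht₀pos, hφ₁, h0]
  obtain ⟨ρ, hρ, hρeq⟩ := exists_rpow_div_Gamma_eq ht₀ hpos hlt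
  have huniq : ∀ σ ∈ Ioo (0 : ℝ) 1, t₀ ^ (σ - 1) / Real.Gamma σ = d₀ / φ₁ → σ = ρ :=
    fun σ hσ h => (strictMonoOn_rpow_div_Gamma ht₀).injOn (Ioo_subset_Ioc_self hσ)
      (Ioo_subset_Ioc_self hρ) (h.trans hρeq.symm)
  refine ⟨cosSeries ρ (cosCoeff φ), ρ, ⟨hρ, hsol hρ, ?_⟩, ?_, ⟨hρeq, huniq⟩, ?_⟩
  · rw [hmean hρ, hρeq, mul_div_cancel₀ _ hφ₁0]
  · intro v σ hv
    have hσ := hv.order_mem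
    have hvu := hv.forward.unique hσ (hsol hσ)
    have hobs : φ₁ * (t₀ ^ (σ - 1) / Real.Gamma σ) = d₀ := by
      rw [← hmean hσ, ← hv.observation]
      refine intervalIntegral.integral_congr fun x hx => ?_
      rw [uIcc_of_le Real.pi_pos.le] at hx
      exact (hvu x hx t₀ ht₀pos).symm
    have hσρ := huniq σ hσ (by rw [← hobs, mul_div_cancel_left₀ _ hφ₁0])
    exact ⟨hσρ, hσρ ▸ hvu⟩
  · intro x _ t ht
    simpa only [relaxation, mul_assoc] using hasSum_cosSeries hρ hc x ht
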